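/- **Proposition (Doob–Meyer, measurably in $P$).** Let $\Omega$ be a separable metric space with Borel $\sigma$-field $\mathcal F$, and let $\mathbb F=(\mathcal F_t)_{t\ge 0}$ be a filtration of sub-$\sigma$-fields of $\mathcal F$ such that each $\mathcal F_t$ is countably generated. Let $\mathbb F_+=(\mathcal F_{t+})_{t\ge0}$, $\mathcal F_{t+}=\bigcap_{u>t}\mathcal F_u$. For a probability measure $P$ on $(\Omega,\mathcal F)$, let $\mathcal N^P$ be the $\sigma$-field generated by the sets $N\in\mathcal F$ with $P(N)=0$, and let $\mathbb F^P_+=(\mathcal F^P_{t+})_{t\ge0}$ with $\mathcal F^P_{t+}=\mathcal F_{t+}\vee\mathcal N^P$ be the usual augmentation. A process is called $\mathbb F^P_+$-predictable if it is measurable for the $\sigma$-field on $\mathbb R_+\times\Omega$ generated by the sets $\{0\}\times A$ with $A\in\mathcal N^P$ and $(t,\infty)\times A$ with $t\ge0$, $A\in\mathcal F^P_{t+}$. (The $\sigma$-field at time $0-$ is the augmented trivial one.) Let $\mathfrak P$ be a Borel subset of the space of all probability measures on $(\Omega,\mathcal F)$ with the topology of weak convergence. Let $\mathfrak P\times\Omega\times\mathbb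 R_+\to\mathbb R$, $(P,\omega,t)\mapsto S^P_t(\omega)$, be measurable for $\mathcal B(\mathfrak P)\otimes\mathcal F\otimes\mathcal B(\mathbb R_+)$ and such that for every $P\in\mathfrak P$ the process $S^P$ has right-continuous paths (for every $\omega$), is $\mathbb F_+$-adapted, is a submartingale with respect to $P$ and $\mathbb F^P_+$, and is of class D, that is, the family of all $S^P_\tau$, where $\tau$ ranges over the finite $\mathbb F^P_+$-stopping times, is uniformly integrable under $P$. Then there exists a measurable function $\mathfrak P\times\Omega\times\mathbb R_+\to\mathbb R$, $(P,\omega,t)\mapsto A^P_t(\omega)$, such that for every $P\in\mathfrak P$, - $S^P-S^P_0-A^P$ is a martingale with respect to $P$ and $\mathbb F^P_+$; - $A^P$ has right-continuous paths (for every $\omega$), is $\mathbb F_+$-adapted and $\mathbb F^P_+$-predictable, and $P$-almost all of its paths are increasing (in the weak sense). -/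

import Mathlib

open MeasureTheory
open scoped NNReal

namespace DoobMeyer

variable {Ω : Type*} {m : MeasurableSpace Ω}

/-- The sigma-field generated by the `P`-null sets of `(Ω, m)`. This is the augmentation of the
trivial sigma-field `{∅, Ω}`, that is, the sigma-field attached to the time `0-`. -/
@[reducible]
def nullSigma (P : Measure Ω) : MeasurableSpace Ω :=
  MeasurableSpace.generateFrom {N | MeasurableSet[m] N ∧ P N = 0}

theorem nullSigma_le (P : Measure Ω) : nullSigma P ≤ m :=
  MeasurableSpace.generateFrom_le fun _ h => h.1

/-- The usual augmentation of a filtration `𝓕`: all `P`-null sets of `(Ω, m)` are adjoined to each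
sigma-field of the right-continuous version of `𝓕`. -/
noncomputable def usualAugmentation (𝓕 : Filtration ℝ≥0 m) (P : Measure Ω) :
    Filtration ℝ≥0 m where
  seq t := 𝓕.rightCont t ⊔ nullSigma P
  mono' _ _ h := sup_le_sup_right (𝓕.rightCont.mono h) _
  le' t := sup_le (𝓕.rightCont.le t) (nullSigma_le P)

/-- The predictable sigma-field on `ℝ≥0 × Ω` of a filtration `𝓖` for which the sigma-field at time
`0-` is `𝓖₀`: it is generated by the sets `{0} × A` with `A ∈ 𝓖₀` and `(t, ∞) × A` with
`A ∈ 𝓖 t`. -/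
@[reducible]
def predictableSigma (𝓖₀ : MeasurableSpace Ω) (𝓖 : Filtration ℝ≥0 m) :
    MeasurableSpace (ℝ≥0 × Ω) :=
  MeasurableSpace.generateFrom
    ({s | ∃ A, MeasurableSet[𝓖₀] A ∧ s = {0} ×ˢ A} ∪
      {s | ∃ t A, MeasurableSet[𝓖 t] A ∧ s = Set.Ioi t ×ˢ A})

/-- Predictability with respect to the usual augmentation of `𝓕` under `P`. -/
def IsAugPredictable (𝓕 : Filtration ℝ≥0 m) (P : Measure Ω) (X : ℝ≥0 → Ω → ℝ) : Prop :=
  Measurable[predictableSigma (nullSigma P) (usualAugmentation 𝓕 P)]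
    (fun x : ℝ≥0 × Ω => X x.1 x.2)

/-- All paths are right-continuous. -/
def RightContinuousPaths (X : ℝ≥0 → Ω → ℝ) : Prop :=
  ∀ ω t, ContinuousWithinAt (fun s => X s ω) (Set.Ici t) t

/-- Class D: the random variables `X_τ`, where `τ` runs through all finite stopping times, are
uniformly integrable. -/
def IsClassD (X : ℝ≥0 → Ω → ℝ) (𝓖 : Filtration ℝ≥0 m) (P : Measure Ω) : Prop :=
  UniformIntegrable
    (fun τ : {τ : Ω → WithTop ℝ≥0 // IsStoppingTime 𝓖 τ ∧ ∀ ω, τ ω ≠ ⊤} =>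
      stoppedValue X τ.1) 1 P

/-- Joint measurability of `(P, ω, t) ↦ X P t ω` on `𝔓 × Ω × ℝ≥0` for a set `𝔓` of probability
measures, where `𝔓` carries the Borel sigma-field of the topology of weak convergence. -/
def JointlyMeasurable [TopologicalSpace Ω] [OpensMeasurableSpace Ω]
    {𝔓 : Set (ProbabilityMeasure Ω)} (X : 𝔓 → ℝ≥0 → Ω → ℝ) : Prop :=
  Measurable[(borel 𝔓).prod inferInstance]
    (fun x : 𝔓 × Ω × ℝ≥0 => X x.1 x.2.2 x.2.1)

end DoobMeyer

namespace DoobMeyer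

open ProbabilityTheory Filter Topology
open scoped ENNReal

/-! ### Iterated midpoints -/

/-! The compensator is a limit of discrete Doob compensators. On the dyadic grid of mesh `2⁻ⁿ`, let
`a n l ≥ 0` be the conditional expectation of the increment of `S` over the `l`-th interval given
the past. The partial sums of `a n` compensate `S` along the grid, and class D makes them uniformly
integrable, uniformly in `n` and in the time (`IsCompensator.exists_excess_le`).

A uniformly integrable sequence of nonnegative functions need not converge, but iterated midpoints
of its tails can be chosen to converge in `L¹`. One takes almost minimizers of the mean of `exp
(-g)`: by strict convexity, two almost minimizers whose midpoint is also a candidate must be close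
(`cauchy_of_almost_minimizer`). Applied on `Ω × ℕ`, with a weight on each integer time, this gives
convergence at all integer times with a single choice of midpoints. Contractivity of conditional
expectations carries it down to all dyadic times.

Measurability in `P` comes from two sources. Midpoints are coded by the countable type `MidTree`, so
the first admissible tree or index in an enumeration depends measurably on `P`; limits are replaced
by upper limits, which need no further choice. Conditional expectations given a countably generated
sigma-field are measurable in `P` because Radon–Nikodym derivatives of kernels are jointly
measurable. The sigma-field at `t+` is a decreasing intersection of such sigma-fields and is reached
by `L¹` convergence along it (`exists_measurable_condExp_iInf`).

The upper limit `upperSum` of the midpoints is predictable, since the step processes are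
left-continuous; its right limit `regSum` is right-continuous and adapted, and takes values in `[0,
∞]`. Uniform integrability and the right-continuity of `S` turn the grid identities into the
martingale property (`IsFastCompensator.martingale`). For predictability, the two processes must be
indistinguishable. Always `upperSum ≤ regSum`; at a bounded stopping time `τ`, rounding up to the
grid and optional sampling bound the mean of `regSum` at `τ` by that of every midpoint process at
`τ`, and the reverse Fatou lemma then forces equality almost surely. A path with `upperSum < regSum`
at some time `t` would have a rational level first reached by `regSum` exactly at `t`, so the
countably many hitting times of rational levels exclude such paths
(`IsFastCompensator.ae_upperSum_eq_regSum`). -/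

/-- Binary trees with leaves labelled by natural numbers; they encode the iterated midpoints
of a sequence. -/
inductive MidTree : Type
  | leaf : ℕ → MidTree
  | node : MidTree → MidTree → MidTree

namespace MidTree

/-- The iterated midpoint of a sequence that is encoded by a tree. -/
noncomputable def eval : MidTree → (ℕ → ℝ) → ℝ
  | leaf n, f => f n
  | node a b, f => (a.eval f + b.eval f) / 2

/-- All labels of the tree are at least `k`. -/
def LeavesGE (k : ℕ) : MidTree → Prop
  | leaf n => k ≤ n
  | node a b => a.LeavesGE k ∧ b.LeavesGE k

/-- An injective code of trees by natural numbers. -/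
def code : MidTree → ℕ
  | leaf n => 2 * n
  | node a b => 2 * Nat.pair a.code b.code + 1

theorem code_injective : Function.Injective code := by
  intro a
  induction a with
  | leaf n =>
    intro b h
    cases b with
    | leaf m => simp only [code] at h; congr 1; omega
    | node b₁ b₂ => simp only [code] at h; omega
  | node a₁ a₂ ih₁ ih₂ =>
    intro b h
    cases b with
    | leaf m => simp only [code] at h; omega
    | node b₁ b₂ =>
      simp only [code] at h
      have h' : Nat.pair a₁.code a₂.code = Nat.pair b₁.code b₂.code := by omega
      obtain ⟨h₁, h₂⟩ := Nat.pair_eq_pair.1 h'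
      rw [ih₁ h₁, ih₂ h₂]

instance : Countable MidTree := code_injective.countable

instance : Nonempty MidTree := ⟨leaf 0⟩

instance : MeasurableSpace MidTree := ⊤

instance : MeasurableSingletonClass MidTree := ⟨fun _ => trivial⟩

theorem LeavesGE.mono {k l : ℕ} (h : k ≤ l) : ∀ {w : MidTree}, w.LeavesGE l → w.LeavesGE k
  | leaf _, hw => h.trans hw
  | node _ _, hw => ⟨hw.1.mono h, hw.2.mono h⟩

theorem LeavesGE.node {k : ℕ} {a b : MidTree} (ha : a.LeavesGE k) (hb : b.LeavesGE k) :
    (node a b).LeavesGE k := ⟨ha, hb⟩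

/-- A property of functions that is stable under midpoints passes from the members of a sequence
of functions to its iterated midpoints. -/
theorem eval_induction {X : Type*} {Q : (X → ℝ) → Prop} {f : ℕ → X → ℝ} {k : ℕ}
    (hmid : ∀ g h, Q g → Q h → Q (fun x => (g x + h x) / 2)) (hf : ∀ n, k ≤ n → Q (f n)) :
    ∀ {w : MidTree}, w.LeavesGE k → Q (fun x => w.eval (fun n => f n x))
  | leaf _, hw => hf _ hw
  | MidTree.node _ _, hw => hmid _ _ (eval_induction hmid hf hw.1) (eval_induction hmid hf hw.2)

theorem leavesGE_zero : ∀ w : MidTree, w.LeavesGE 0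
  | leaf _ => Nat.zero_le _
  | MidTree.node a b => ⟨leavesGE_zero a, leavesGE_zero b⟩

theorem eval_mono {f g : ℕ → ℝ} (h : ∀ n, f n ≤ g n) : ∀ w : MidTree, w.eval f ≤ w.eval g
  | leaf n => h n
  | MidTree.node a b => by
    have h₁ := eval_mono h a
    have h₂ := eval_mono h b
    simp only [eval]; linarith

theorem eval_nonneg {f : ℕ → ℝ} (h : ∀ n, 0 ≤ f n) : ∀ w : MidTree, 0 ≤ w.eval f
  | leaf n => h n
  | MidTree.node a b => by
    have h₁ := eval_nonneg h a
    have h₂ := eval_nonneg h b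
    simp only [eval]; linarith

theorem eval_zero : ∀ w : MidTree, w.eval (fun _ => 0) = 0
  | leaf _ => rfl
  | MidTree.node a b => by simp only [eval, eval_zero a, eval_zero b]; norm_num

theorem measurable_eval {X : Type*} [MeasurableSpace X] {f : ℕ → X → ℝ}
    (hf : ∀ n, Measurable (f n)) (w : MidTree) : Measurable (fun x => w.eval (fun n => f n x)) :=
  eval_induction (Q := Measurable) (k := 0) (fun _ _ hg hh => (hg.add hh).div_const 2)
    (fun n _ => hf n) w.leavesGE_zero

end MidTree

/-! ### A compactness principle in `L¹` -/

/-- On `(-∞, c]` the derivative of `t ↦ exp (-t / 2)` has modulus at least `exp (-c / 2) / 2`, which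
controls distances below the level `c`; what lies above `c` is paid for by the excess terms. -/
theorem abs_sub_le_exp {x y c : ℝ} :
    |x - y| ≤ 2 * Real.exp (c / 2) * |Real.exp (-x / 2) - Real.exp (-y / 2)|
      + max (x - c) 0 + max (y - c) 0 := by
  wlog hxy : x ≤ y generalizing x y
  · have := this (le_of_not_ge hxy)
    rw [abs_sub_comm x y, abs_sub_comm (Real.exp (-x / 2))]
    linarith
  have hmono : Real.exp (-y / 2) ≤ Real.exp (-x / 2) := Real.exp_le_exp.2 (by linarith)
  rw [abs_sub_comm x y, abs_of_nonneg (sub_nonneg.2 hxy), abs_of_nonneg (sub_nonneg.2 hmono)]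
  have hE : 0 ≤ 2 * Real.exp (c / 2) * (Real.exp (-x / 2) - Real.exp (-y / 2)) :=
    mul_nonneg (by positivity) (sub_nonneg.2 hmono)
  rcases le_total c x with hc | hc
  · linarith [le_max_left (y - c) 0, le_max_right (x - c) 0]
  have key : ∀ y', x ≤ y' → y' ≤ c →
      y' - x ≤ 2 * Real.exp (c / 2) * (Real.exp (-x / 2) - Real.exp (-y' / 2)) := by
    intro y' _ h2
    have e1 : Real.exp (c / 2) * Real.exp (-x / 2)
        = Real.exp ((c - y') / 2) * Real.exp ((y' - x) / 2) := by
      rw [← Real.exp_add, ← Real.exp_add]; congr 1; ring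
    have e2 : Real.exp (c / 2) * Real.exp (-y' / 2) = Real.exp ((c - y') / 2) := by
      rw [← Real.exp_add]; congr 1; ring
    have h3 : (y' - x) / 2 + 1 ≤ Real.exp ((y' - x) / 2) := Real.add_one_le_exp _
    have h4 : 1 ≤ Real.exp ((c - y') / 2) := Real.one_le_exp (by linarith)
    calc y' - x ≤ 2 * (1 * (Real.exp ((y' - x) / 2) - 1)) := by linarith
      _ ≤ 2 * (Real.exp ((c - y') / 2) * (Real.exp ((y' - x) / 2) - 1)) := by
          gcongr; linarith
      _ = _ := by linear_combination (-2) * e1 + 2 * e2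
  rcases le_total y c with hy | hy
  · linarith [key y hxy hy, le_max_right (x - c) 0, le_max_right (y - c) 0]
  · have h1 := key c hc le_rfl
    have h2 : Real.exp (-y / 2) ≤ Real.exp (-c / 2) := Real.exp_le_exp.2 (by linarith)
    have h3 : 2 * Real.exp (c / 2) * (Real.exp (-x / 2) - Real.exp (-c / 2))
        ≤ 2 * Real.exp (c / 2) * (Real.exp (-x / 2) - Real.exp (-y / 2)) := by gcongr
    linarith [le_max_left (y - c) 0, le_max_right (x - c) 0]

/-- The midpoint convexity defect of `exp (-·)` is exactly the square of the difference of the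
values of `exp (-· / 2)`, and `C * u ≤ η + C ^ 2 / η * u ^ 2` turns that difference into its square.
-/
theorem abs_sub_le_exp_sq {x y c η : ℝ} (hη : 0 < η) :
    |x - y| ≤ (η + (2 * Real.exp (c / 2)) ^ 2 / η *
        (Real.exp (-x) + Real.exp (-y) - 2 * Real.exp (-((x + y) / 2))))
      + max (x - c) 0 + max (y - c) 0 := by
  refine (abs_sub_le_exp (c := c)).trans ?_
  set C := 2 * Real.exp (c / 2)
  set u := |Real.exp (-x / 2) - Real.exp (-y / 2)| with hu
  have h1 : Real.exp (-x) + Real.exp (-y) - 2 * Real.exp (-((x + y) / 2)) = u ^ 2 := by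
    rw [hu, sq_abs]
    have e1 : Real.exp (-x) = Real.exp (-x / 2) ^ 2 := by
      rw [sq, ← Real.exp_add]; congr 1; ring
    have e2 : Real.exp (-y) = Real.exp (-y / 2) ^ 2 := by
      rw [sq, ← Real.exp_add]; congr 1; ring
    have e3 : Real.exp (-((x + y) / 2)) = Real.exp (-x / 2) * Real.exp (-y / 2) := by
      rw [← Real.exp_add]; congr 1; ring
    rw [e1, e2, e3]; ring
  have h2 : C * u ≤ η + C ^ 2 / η * u ^ 2 := by
    have h3 : η + C ^ 2 / η * u ^ 2 - C * u = ((C * u - η / 2) ^ 2 + 3 / 4 * η ^ 2) / η := by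
      field_simp; ring
    have h4 : 0 ≤ ((C * u - η / 2) ^ 2 + 3 / 4 * η ^ 2) / η := by positivity
    linarith
  rw [h1]; linarith

section Komlos

variable {X : Type*} [MeasurableSpace X] {μ : Measure X}

/-- The mean of `exp (-g)`, where `g` is an iterated midpoint of a sequence of functions. -/
noncomputable def expMean (μ : Measure X) (f : ℕ → X → ℝ) (w : MidTree) : ℝ :=
  ∫ x, Real.exp (-w.eval (fun n => f n x)) ∂μ

theorem integrable_exp_neg_eval [IsProbabilityMeasure μ] {f : ℕ → X → ℝ}
    (hf : ∀ n, Measurable (f n)) (h0 : ∀ n x, 0 ≤ f n x) (w : MidTree) :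
    Integrable (fun x => Real.exp (-w.eval (fun n => f n x))) μ := by
  refine Integrable.of_bound (C := 1)
    ((MidTree.measurable_eval hf w).neg.exp.aestronglyMeasurable) (ae_of_all _ fun x => ?_)
  rw [Real.norm_eq_abs, abs_of_pos (Real.exp_pos _)]
  exact Real.exp_le_one_iff.2 (neg_nonpos.2 (w.eval_nonneg fun n => h0 n x))

theorem expMean_nonneg (f : ℕ → X → ℝ) (w : MidTree) : 0 ≤ expMean μ f w :=
  integral_nonneg fun _ => (Real.exp_pos _).le

theorem expMean_le_one [IsProbabilityMeasure μ] {f : ℕ → X → ℝ}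
    (hf : ∀ n, Measurable (f n)) (h0 : ∀ n x, 0 ≤ f n x) (w : MidTree) : expMean μ f w ≤ 1 := by
  have h := integral_mono (integrable_exp_neg_eval (μ := μ) hf h0 w) (integrable_const (1 : ℝ))
    fun x => Real.exp_le_one_iff.2 (neg_nonpos.2 (w.eval_nonneg fun n => h0 n x))
  simpa [expMean] using h

/-- The infimum of `expMean` over the trees with labels at least `k`. -/
noncomputable def expMeanInf (μ : Measure X) (f : ℕ → X → ℝ) (k : ℕ) : ℝ :=
  sInf (expMean μ f '' {w | w.LeavesGE k})

theorem expMeanInf_le {f : ℕ → X → ℝ} {k : ℕ} {w : MidTree} (hw : w.LeavesGE k) :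
    expMeanInf μ f k ≤ expMean μ f w :=
  csInf_le ⟨0, by rintro _ ⟨w, -, rfl⟩; exact expMean_nonneg f w⟩ ⟨w, hw, rfl⟩

theorem le_expMeanInf {f : ℕ → X → ℝ} {k : ℕ} {b : ℝ}
    (h : ∀ w : MidTree, w.LeavesGE k → b ≤ expMean μ f w) : b ≤ expMeanInf μ f k :=
  le_csInf ⟨_, .leaf k, le_refl k, rfl⟩ (by rintro _ ⟨w, hw, rfl⟩; exact h w hw)

theorem exists_expMean_lt (f : ℕ → X → ℝ) (k : ℕ) {δ : ℝ} (hδ : 0 < δ) :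
    ∃ w : MidTree, w.LeavesGE k ∧ expMean μ f w < expMeanInf μ f k + δ := by
  obtain ⟨_, ⟨w, hw, rfl⟩, h⟩ := exists_lt_of_csInf_lt
    (s := expMean μ f '' {w | w.LeavesGE k}) ⟨_, .leaf k, le_refl k, rfl⟩
    (lt_add_of_pos_right (expMeanInf μ f k) hδ)
  exact ⟨w, hw, h⟩

theorem bddAbove_expMeanInf [IsProbabilityMeasure μ] {f : ℕ → X → ℝ}
    (hf : ∀ n, Measurable (f n)) (h0 : ∀ n x, 0 ≤ f n x) :
    BddAbove (Set.range (expMeanInf μ f)) :=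
  ⟨1, by
    rintro _ ⟨k, rfl⟩
    exact (expMeanInf_le (w := .leaf k) (le_refl k)).trans (expMean_le_one hf h0 _)⟩

theorem exists_expMeanInf_gt (μ : Measure X) (f : ℕ → X → ℝ) {δ : ℝ} (hδ : 0 < δ) :
    ∃ n, ⨆ k, expMeanInf μ f k < expMeanInf μ f n + δ := by
  obtain ⟨n, hn⟩ := exists_lt_of_lt_ciSup (sub_lt_self (⨆ k, expMeanInf μ f k) hδ)
  exact ⟨n, by linarith⟩

/-- Trees with large labels whose `expMean` is almost minimal exist. -/
theorem exists_almost_minimizer [IsProbabilityMeasure μ] {f : ℕ → X → ℝ}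
    (hf : ∀ n, Measurable (f n)) (h0 : ∀ n x, 0 ≤ f n x) (j : ℕ) :
    ∃ z : MidTree, z.LeavesGE j ∧ ∃ n, ∀ w : MidTree, w.LeavesGE n →
      expMean μ f z ≤ expMean μ f w + (1 / 2) ^ j := by
  have hδ : (0 : ℝ) < (1 / 2) ^ j / 2 := by positivity
  obtain ⟨n, hn⟩ := exists_expMeanInf_gt μ f hδ
  obtain ⟨z, hz, hz'⟩ := exists_expMean_lt (μ := μ) f j hδ
  refine ⟨z, hz, n, fun w hw => ?_⟩
  have h1 := le_ciSup (bddAbove_expMeanInf (μ := μ) hf h0) j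
  have h2 := expMeanInf_le (μ := μ) (f := f) hw
  linarith

/-- The infima over tails increase with the tail. Almost minimality beyond an index depending on `j`
bounds `expMean` at `z j` by the supremum of the infima plus `(1 / 2) ^ j`, and one tail already
attains this supremum up to `δ / 2`; so a single threshold `J` serves all later `j`. -/
theorem expMean_le_of_almost_minimizer [IsProbabilityMeasure μ] {f : ℕ → X → ℝ}
    (hf : ∀ n, Measurable (f n)) (h0 : ∀ n x, 0 ≤ f n x) {z : ℕ → MidTree}
    (hmin : ∀ j, ∃ n, ∀ w : MidTree, w.LeavesGE n →
      expMean μ f (z j) ≤ expMean μ f w + (1 / 2) ^ j) {δ : ℝ} (hδ : 0 < δ) :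
    ∃ J, ∀ j ≥ J, ∀ w : MidTree, w.LeavesGE J → expMean μ f (z j) ≤ expMean μ f w + δ := by
  obtain ⟨n, hn⟩ := exists_expMeanInf_gt μ f (half_pos hδ)
  obtain ⟨m, hm⟩ := exists_pow_lt_of_lt_one (half_pos hδ) (by norm_num : (1 / 2 : ℝ) < 1)
  refine ⟨max n m, fun j hj w hw => ?_⟩
  obtain ⟨N, hN⟩ := hmin j
  have h1 : expMean μ f (z j) - (1 / 2) ^ j ≤ expMeanInf μ f N :=
    le_expMeanInf fun w hw => by linarith [hN w hw]
  have h2 := le_ciSup (bddAbove_expMeanInf (μ := μ) hf h0) N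
  have h3 := expMeanInf_le (μ := μ) (f := f) (hw.mono (le_max_left n m))
  have h4 : ((1 : ℝ) / 2) ^ j ≤ (1 / 2) ^ m :=
    pow_le_pow_of_le_one (by norm_num) (by norm_num) ((le_max_right n m).trans hj)
  linarith

/-- The excess over a level is a convex functional. -/
theorem lintegral_excess_eval_le {f : ℕ → X → ℝ} (hf : ∀ n, Measurable (f n)) {c : ℝ}
    {b : ℝ≥0∞} (hb : ∀ n, ∫⁻ x, ENNReal.ofReal (f n x - c) ∂μ ≤ b) (w : MidTree) :
    ∫⁻ x, ENNReal.ofReal (w.eval (fun n => f n x) - c) ∂μ ≤ b := by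
  refine (MidTree.eval_induction (f := f)
    (Q := fun g => Measurable g ∧ ∫⁻ x, ENNReal.ofReal (g x - c) ∂μ ≤ b)
    (k := 0) ?_ (fun n _ => ⟨hf n, hb n⟩) w.leavesGE_zero).2
  rintro g h ⟨hg, hg'⟩ ⟨hh, hh'⟩
  refine ⟨(hg.add hh).div_const 2, ?_⟩
  have hp : ∀ x, ENNReal.ofReal ((g x + h x) / 2 - c)
      ≤ 2⁻¹ * (ENNReal.ofReal (g x - c) + ENNReal.ofReal (h x - c)) := fun x => by
    have e : (2⁻¹ : ℝ≥0∞) = ENNReal.ofReal 2⁻¹ := by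
      rw [ENNReal.ofReal_inv_of_pos two_pos]; simp
    rw [show (g x + h x) / 2 - c = 2⁻¹ * ((g x - c) + (h x - c)) by ring,
      ENNReal.ofReal_mul (by norm_num), e]
    gcongr
    exact ENNReal.ofReal_add_le
  calc ∫⁻ x, ENNReal.ofReal ((g x + h x) / 2 - c) ∂μ
      ≤ ∫⁻ x, 2⁻¹ * (ENNReal.ofReal (g x - c) + ENNReal.ofReal (h x - c)) ∂μ :=
        lintegral_mono hp
    _ = 2⁻¹ * (∫⁻ x, ENNReal.ofReal (g x - c) ∂μ + ∫⁻ x, ENNReal.ofReal (h x - c) ∂μ) := by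
        rw [lintegral_const_mul _ (by fun_prop), lintegral_add_left (by fun_prop)]
    _ ≤ 2⁻¹ * (b + b) := by gcongr
    _ = b := by
        rw [← two_mul, ← mul_assoc, ENNReal.inv_mul_cancel (by norm_num) (by norm_num), one_mul]

/-- Almost minimizers of `expMean` form a Cauchy sequence in `L¹`. -/
theorem cauchy_of_almost_minimizer [IsProbabilityMeasure μ] {f : ℕ → X → ℝ}
    (hf : ∀ n, Measurable (f n)) (h0 : ∀ n x, 0 ≤ f n x)
    (hUI : ∀ ε : ℝ, 0 < ε → ∃ c : ℝ, ∀ n,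
      ∫⁻ x, ENNReal.ofReal (f n x - c) ∂μ ≤ ENNReal.ofReal ε)
    {z : ℕ → MidTree} (hz : ∀ j, (z j).LeavesGE j)
    (hmin : ∀ j, ∃ n, ∀ w : MidTree, w.LeavesGE n →
      expMean μ f (z j) ≤ expMean μ f w + (1 / 2) ^ j) {ε : ℝ} (hε : 0 < ε) :
    ∃ J, ∀ i ≥ J, ∀ j ≥ J, ∫⁻ x, ‖(z i).eval (fun n => f n x) - (z j).eval (fun n => f n x)‖ₑ ∂μ
      ≤ ENNReal.ofReal ε := by
  obtain ⟨c, hc⟩ := hUI (ε / 4) (by positivity)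
  set C := (2 * Real.exp (c / 2)) ^ 2 / (ε / 4) with hC
  have hCpos : 0 < C := by positivity
  -- With this tolerance, the two almost-minimality gaps multiplied by `C` add up to `ε / 4`.
  obtain ⟨J, hJ⟩ := expMean_le_of_almost_minimizer (μ := μ) hf h0 hmin
    (δ := ε / 4 / (2 * C)) (by positivity)
  refine ⟨J, fun i hi j hj => ?_⟩
  set gi := fun x => (z i).eval (fun n => f n x)
  set gj := fun x => (z j).eval (fun n => f n x)
  have hgi : Measurable gi := MidTree.measurable_eval hf _
  have hgj : Measurable gj := MidTree.measurable_eval hf _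
  -- The midpoint of the two almost minimizers is itself a competitor, so neither can beat it by
  -- much in the wrong direction: the mean convexity defect is small.
  have hmid := ((hz i).mono hi).node ((hz j).mono hj)
  set q := fun x => ε / 4 + C * (Real.exp (-gi x) + Real.exp (-gj x)
    - 2 * Real.exp (-((gi x + gj x) / 2))) with hq
  have hq0 : ∀ x, 0 ≤ q x := fun x => by
    have h1 : Real.exp (-gi x) + Real.exp (-gj x) - 2 * Real.exp (-((gi x + gj x) / 2))
        = (Real.exp (-gi x / 2) - Real.exp (-gj x / 2)) ^ 2 := by
      have e1 : Real.exp (-gi x) = Real.exp (-gi x / 2) ^ 2 := by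
        rw [sq, ← Real.exp_add]; congr 1; ring
      have e2 : Real.exp (-gj x) = Real.exp (-gj x / 2) ^ 2 := by
        rw [sq, ← Real.exp_add]; congr 1; ring
      have e3 : Real.exp (-((gi x + gj x) / 2)) = Real.exp (-gi x / 2) * Real.exp (-gj x / 2) := by
        rw [← Real.exp_add]; congr 1; ring
      rw [e1, e2, e3]; ring
    simp only [hq, h1]; positivity
  have hi1 : Integrable (fun x => Real.exp (-gi x)) μ := integrable_exp_neg_eval hf h0 _
  have hi2 : Integrable (fun x => Real.exp (-gj x)) μ := integrable_exp_neg_eval hf h0 _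
  have hi3 : Integrable (fun x => Real.exp (-((gi x + gj x) / 2))) μ :=
    integrable_exp_neg_eval hf h0 (.node (z i) (z j))
  have hi4 : Integrable (fun x => Real.exp (-gi x) + Real.exp (-gj x)) μ := hi1.add hi2
  have hi5 : Integrable (fun x => Real.exp (-gi x) + Real.exp (-gj x)
      - 2 * Real.exp (-((gi x + gj x) / 2))) μ := hi4.sub (hi3.const_mul 2)
  have hqi : Integrable q μ := (integrable_const _).add (hi5.const_mul C)
  have hqI : ∫ x, q x ∂μ ≤ ε / 2 := by
    have e : ∫ x, q x ∂μ = ε / 4 + C * (expMean μ f (z i) + expMean μ f (z j)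
        - 2 * expMean μ f (.node (z i) (z j))) := by
      simp only [hq]
      rw [integral_add (integrable_const _) (hi5.const_mul C),
        integral_const_mul, integral_sub hi4 (hi3.const_mul 2), integral_add hi1 hi2,
        integral_const_mul]
      simp [expMean, gi, gj, MidTree.eval]
    rw [e]
    have h1 := hJ i hi _ hmid
    have h2 := hJ j hj _ hmid
    have h3 : C * (expMean μ f (z i) + expMean μ f (z j) - 2 * expMean μ f (.node (z i) (z j)))
        ≤ C * (2 * (ε / 4 / (2 * C))) := by gcongr; linarith
    have h4 : C * (2 * (ε / 4 / (2 * C))) = ε / 4 := by field_simp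
    linarith
  have hpt : ∀ x, ‖gi x - gj x‖ₑ
      ≤ ENNReal.ofReal (q x) + ENNReal.ofReal (gi x - c) + ENNReal.ofReal (gj x - c) := fun x => by
    rw [Real.enorm_eq_ofReal_abs]
    have h := abs_sub_le_exp_sq (x := gi x) (y := gj x) (c := c) (η := ε / 4) (by positivity)
    refine (ENNReal.ofReal_le_ofReal h).trans ?_
    have hm : ∀ r : ℝ, ENNReal.ofReal (max r 0) = ENNReal.ofReal r := fun r => by
      rcases le_total r 0 with h | h
      · simp [h, ENNReal.ofReal_of_nonpos h]
      · simp [h]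
    rw [← hm (gi x - c), ← hm (gj x - c)]
    exact ENNReal.ofReal_add_le.trans (by gcongr; exact ENNReal.ofReal_add_le)
  calc ∫⁻ x, ‖gi x - gj x‖ₑ ∂μ
      ≤ ∫⁻ x, (ENNReal.ofReal (q x) + ENNReal.ofReal (gi x - c) + ENNReal.ofReal (gj x - c)) ∂μ :=
        lintegral_mono hpt
    _ = ∫⁻ x, ENNReal.ofReal (q x) ∂μ + ∫⁻ x, ENNReal.ofReal (gi x - c) ∂μ
        + ∫⁻ x, ENNReal.ofReal (gj x - c) ∂μ := by
        rw [lintegral_add_right _ (by fun_prop), lintegral_add_right _ (by fun_prop)]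
    _ ≤ ENNReal.ofReal (ε / 2) + ENNReal.ofReal (ε / 4) + ENNReal.ofReal (ε / 4) := by
        gcongr
        · rw [← ofReal_integral_eq_lintegral_ofReal hqi (ae_of_all _ hq0)]
          exact ENNReal.ofReal_le_ofReal hqI
        · exact lintegral_excess_eval_le hf hc _
        · exact lintegral_excess_eval_le hf hc _
    _ = ENNReal.ofReal ε := by
        rw [← ENNReal.ofReal_add (by positivity) (by positivity),
          ← ENNReal.ofReal_add (by positivity) (by positivity)]
        congr 1; ring

end Komlos


/-! ### Measurable selection of fast subsequences -/

section Selection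

variable {𝔓 X : Type*} [MeasurableSpace 𝔓] [MeasurableSpace X]

theorem measurable_comp_countable {ι E : Type*} [Countable ι] [MeasurableSpace ι]
    [MeasurableSingletonClass ι] [MeasurableSpace E] {g : ι → 𝔓 → X → E}
    (hg : ∀ i, Measurable (fun q : 𝔓 × X => g i q.1 q.2)) {j : 𝔓 → ι} (hj : Measurable j) :
    Measurable (fun q : 𝔓 × X => g (j q.1) q.1 q.2) := by
  have h : Measurable (fun r : ι × (𝔓 × X) => g r.1 r.2.1 r.2.2) :=
    measurable_from_prod_countable_right hg
  exact h.comp ((hj.comp measurable_fst).prodMk measurable_id)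

theorem measurable_lintegral_enorm_sub (κ : Kernel 𝔓 X) [IsSFiniteKernel κ] {f g : 𝔓 → X → ℝ}
    (hf : Measurable (fun q : 𝔓 × X => f q.1 q.2)) (hg : Measurable (fun q : 𝔓 × X => g q.1 q.2)) :
    Measurable (fun p => ∫⁻ x, ‖f p x - g p x‖ₑ ∂κ p) :=
  Measurable.lintegral_kernel_prod_right' (f := fun q : 𝔓 × X => ‖f q.1 q.2 - g q.1 q.2‖ₑ)
    (hf.sub hg).enorm

/-- A sequence that is Cauchy in `L¹` under each of a measurable family of measures has a
subsequence, measurable in the measure, along which the distances are summable. -/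
theorem exists_measurable_subseq (κ : Kernel 𝔓 X) [IsSFiniteKernel κ] {g : ℕ → 𝔓 → X → ℝ}
    (hg : ∀ n, Measurable (fun q : 𝔓 × X => g n q.1 q.2))
    (hC : ∀ p, ∀ ε : ℝ, 0 < ε → ∃ J, ∀ i ≥ J, ∀ j ≥ J,
      ∫⁻ x, ‖g i p x - g j p x‖ₑ ∂κ p ≤ ENNReal.ofReal ε) :
    ∃ j : ℕ → 𝔓 → ℕ, (∀ k, Measurable (j k)) ∧ (∀ k p, k ≤ j k p) ∧
      ∀ k p, ∫⁻ x, ‖g (j (k + 1) p) p x - g (j k p) p x‖ₑ ∂κ p ≤ ENNReal.ofReal ((1 / 2) ^ k) := by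
  classical
  let Q : ℕ → 𝔓 → ℕ → Prop := fun k p J => k ≤ J ∧ ∀ i ≥ J, ∀ j ≥ J,
    ∫⁻ x, ‖g i p x - g j p x‖ₑ ∂κ p ≤ ENNReal.ofReal ((1 / 2) ^ k)
  have hQ : ∀ k p, ∃ J, Q k p J := fun k p => by
    obtain ⟨J, hJ⟩ := hC p ((1 / 2) ^ k) (by positivity)
    exact ⟨max k J, le_max_left _ _, fun i hi j hj =>
      hJ i ((le_max_right _ _).trans hi) j ((le_max_right _ _).trans hj)⟩
  refine ⟨fun k p => Nat.find (hQ k p), fun k => ?_, fun k p => (Nat.find_spec (hQ k p)).1,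
    fun k p => ?_⟩
  · refine measurable_find (hQ k) fun J => ?_
    simp only [Q, Set.ofPred_and, Set.ofPred_forall]
    refine (MeasurableSet.const _).inter (MeasurableSet.iInter fun i => MeasurableSet.iInter
      fun _ => MeasurableSet.iInter fun j => MeasurableSet.iInter fun _ => ?_)
    exact measurableSet_le (measurable_lintegral_enorm_sub κ (hg i) (hg j)) measurable_const
  · have h1 := Nat.find_spec (hQ (k + 1) p)
    have h2 : Nat.find (hQ k p) ≤ Nat.find (hQ (k + 1) p) := by
      refine Nat.find_min' _ ⟨(Nat.le_succ k).trans h1.1, fun i hi j hj => ?_⟩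
      refine (h1.2 i hi j hj).trans (ENNReal.ofReal_le_ofReal ?_)
      exact pow_le_pow_of_le_one (by norm_num) (by norm_num) (Nat.le_succ k)
    exact (Nat.find_spec (hQ k p)).2 _ h2 _ le_rfl

theorem measurable_expMean (κ : Kernel 𝔓 X) [IsSFiniteKernel κ] {f : ℕ → 𝔓 → X → ℝ}
    (hf : ∀ n, Measurable (fun q : 𝔓 × X => f n q.1 q.2)) (w : MidTree) :
    Measurable (fun p => expMean (κ p) (fun n => f n p) w) := by
  have h : Measurable (fun q : 𝔓 × X => Real.exp (-w.eval (fun n => f n q.1 q.2))) :=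
    (MidTree.measurable_eval hf w).neg.exp
  exact (h.stronglyMeasurable.integral_kernel_prod_right' (κ := κ)).measurable

/-- Komlós-type principle, measurably in a parameter: the iterated midpoints of a sequence of
nonnegative functions that is uniformly integrable under each of a measurable family of probability
measures can be chosen, measurably in the measure, such that they converge fast in `L¹`. -/
theorem exists_measurable_midpoints (κ : Kernel 𝔓 X) [IsMarkovKernel κ] {f : ℕ → 𝔓 → X → ℝ}
    (hf : ∀ n, Measurable (fun q : 𝔓 × X => f n q.1 q.2)) (h0 : ∀ n p x, 0 ≤ f n p x)
    (hUI : ∀ p, ∀ ε : ℝ, 0 < ε → ∃ c : ℝ, ∀ n,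
      ∫⁻ x, ENNReal.ofReal (f n p x - c) ∂κ p ≤ ENNReal.ofReal ε) :
    ∃ w : ℕ → 𝔓 → MidTree, (∀ k, Measurable (w k)) ∧ (∀ k p, (w k p).LeavesGE k) ∧
      ∀ k p, ∫⁻ x, ‖(w (k + 1) p).eval (fun n => f n p x) - (w k p).eval (fun n => f n p x)‖ₑ ∂κ p
        ≤ ENNReal.ofReal ((1 / 2) ^ k) := by
  classical
  have hf' : ∀ p n, Measurable (f n p) := fun p n => (hf n).comp measurable_prodMk_left
  obtain ⟨e, he⟩ := exists_surjective_nat MidTree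
  -- The minimality condition compares with other trees only through countable quantifiers and does
  -- not mention the limiting infimum; the first tree of the enumeration satisfying it is therefore
  -- measurable in `p`.
  let Q : ℕ → 𝔓 → ℕ → Prop := fun j p m => (e m).LeavesGE j ∧ ∃ n, ∀ w : MidTree, w.LeavesGE n →
      expMean (κ p) (fun n => f n p) (e m) ≤ expMean (κ p) (fun n => f n p) w + (1 / 2) ^ j
  have hQ : ∀ j p, ∃ m, Q j p m := fun j p => by
    obtain ⟨z, hz⟩ := exists_almost_minimizer (μ := κ p) (hf' p) (fun n => h0 n p) j
    obtain ⟨m, rfl⟩ := he z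
    exact ⟨m, hz⟩
  let z : ℕ → 𝔓 → MidTree := fun j p => e (Nat.find (hQ j p))
  have hz : ∀ j, Measurable (z j) := fun j => by
    refine (measurable_from_top (f := e)).comp (measurable_find (hQ j) fun m => ?_)
    simp only [Q, Set.ofPred_and, Set.ofPred_forall, Set.ofPred_exists]
    refine (MeasurableSet.const _).inter (MeasurableSet.iUnion fun n => MeasurableSet.iInter
      fun w => MeasurableSet.iInter fun _ => ?_)
    exact measurableSet_le (measurable_expMean κ hf _) ((measurable_expMean κ hf w).add_const _)
  let g : ℕ → 𝔓 → X → ℝ := fun j p x => (z j p).eval (fun n => f n p x)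
  have hg : ∀ j, Measurable (fun q : 𝔓 × X => g j q.1 q.2) := fun j =>
    measurable_comp_countable (g := fun (w : MidTree) p x => w.eval (fun n => f n p x))
      (fun w => MidTree.measurable_eval hf w) (hz j)
  obtain ⟨j, hj, hkj, hdist⟩ := exists_measurable_subseq κ hg fun p ε hε =>
    cauchy_of_almost_minimizer (μ := κ p) (hf' p) (fun n => h0 n p) (hUI p)
      (fun j => (Nat.find_spec (hQ j p)).1) (fun j => (Nat.find_spec (hQ j p)).2) hε
  refine ⟨fun k p => z (j k p) p, fun k => ?_, fun k p =>
    (Nat.find_spec (hQ (j k p) p)).1.mono (hkj k p), hdist⟩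
  have h : Measurable (fun r : ℕ × 𝔓 => z r.1 r.2) := measurable_from_prod_countable_right hz
  exact h.comp ((hj k).prodMk measurable_id)

end Selection

/-! ### Almost sure limits and integrable majorants from summable `L¹` distances. -/

section FastConvergence

variable {X : Type*} [MeasurableSpace X] {μ : Measure X}

theorem enorm_le_add_tsum {h : ℕ → ℝ} (k : ℕ) : ‖h k‖ₑ ≤ ‖h 0‖ₑ + ∑' i, ‖h (i + 1) - h i‖ₑ := by
  have hk : h k = h 0 + ∑ i ∈ Finset.range k, (h (i + 1) - h i) := by
    rw [Finset.sum_range_sub]; ring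
  rw [hk]
  refine (enorm_add_le _ _).trans ?_
  gcongr
  exact (enorm_sum_le _ _).trans (ENNReal.sum_le_tsum _)

theorem measurable_enorm_sub {h : ℕ → X → ℝ} (hm : ∀ k, Measurable (h k)) (i : ℕ) :
    Measurable (fun x => ‖h (i + 1) x - h i x‖ₑ) := ((hm (i + 1)).sub (hm i)).enorm

theorem lintegral_add_tsum_ne_top {h : ℕ → X → ℝ} (hm : ∀ k, Measurable (h k))
    (h0 : ∫⁻ x, ‖h 0 x‖ₑ ∂μ ≠ ∞)
    (hs : ∑' k, ∫⁻ x, ‖h (k + 1) x - h k x‖ₑ ∂μ ≠ ∞) :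
    ∫⁻ x, (‖h 0 x‖ₑ + ∑' i, ‖h (i + 1) x - h i x‖ₑ) ∂μ ≠ ∞ := by
  rw [lintegral_add_left (hm 0).enorm,
    lintegral_tsum fun i => (measurable_enorm_sub hm i).aemeasurable]
  exact ENNReal.add_ne_top.2 ⟨h0, hs⟩

theorem ae_exists_tendsto_of_tsum {h : ℕ → X → ℝ} (hm : ∀ k, Measurable (h k))
    (hs : ∑' k, ∫⁻ x, ‖h (k + 1) x - h k x‖ₑ ∂μ ≠ ∞) :
    ∀ᵐ x ∂μ, ∃ y, Tendsto (fun k => h k x) atTop (𝓝 y) := by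
  rw [← lintegral_tsum fun i => (measurable_enorm_sub hm i).aemeasurable] at hs
  filter_upwards [ae_lt_top (Measurable.tsum (measurable_enorm_sub hm)) hs] with x hx
  refine cauchySeq_tendsto_of_complete (cauchySeq_of_summable_dist ?_)
  have h1 : Summable fun k => ‖h (k + 1) x - h k x‖ := by
    have := ENNReal.summable_toReal hx.ne
    simpa using this
  refine h1.congr fun k => ?_
  rw [dist_comm, dist_eq_norm]

theorem tsum_ofReal_half_pow_ne_top : ∑' k : ℕ, ENNReal.ofReal ((1 / 2) ^ k) ≠ ∞ := by
  rw [← ENNReal.ofReal_tsum_of_nonneg (fun _ => by positivity) summable_geometric_two]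
  exact ENNReal.ofReal_ne_top

end FastConvergence


/-! ### Conditional expectations along a decreasing sequence of sigma-fields -/

section Decreasing

variable {Ω : Type*} {m : MeasurableSpace Ω} {μ : Measure Ω}

/-- This is Pythagoras: the tower property makes the coarser conditional expectation the orthogonal
projection of the finer one. Boundedness of `f` supplies the integrability of all products. -/
theorem integral_sq_condExp_sub [IsProbabilityMeasure μ] {𝒢 ℋ : MeasurableSpace Ω} (h𝒢ℋ : 𝒢 ≤ ℋ)
    (hℋ : ℋ ≤ m) {f : Ω → ℝ} {R : ℝ} (hb : ∀ ω, |f ω| ≤ R) :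
    ∫ ω, ((μ[f | ℋ]) ω - (μ[f | 𝒢]) ω) ^ 2 ∂μ
      = ∫ ω, ((μ[f | ℋ]) ω) ^ 2 ∂μ - ∫ ω, ((μ[f | 𝒢]) ω) ^ 2 ∂μ := by
  have hbℋ : ∀ᵐ ω ∂μ, |(μ[f | ℋ]) ω| ≤ R := ae_bdd_abs_condExp_of_ae_bdd_abs (ae_of_all _ hb)
  have hb𝒢 : ∀ᵐ ω ∂μ, |(μ[f | 𝒢]) ω| ≤ R := ae_bdd_abs_condExp_of_ae_bdd_abs (ae_of_all _ hb)
  have hmℋ : AEStronglyMeasurable[m] (μ[f | ℋ]) μ :=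
    (stronglyMeasurable_condExp.mono hℋ).aestronglyMeasurable
  have hm𝒢 : AEStronglyMeasurable[m] (μ[f | 𝒢]) μ :=
    (stronglyMeasurable_condExp.mono (h𝒢ℋ.trans hℋ)).aestronglyMeasurable
  have hprod : ∀ {g h : Ω → ℝ}, AEStronglyMeasurable[m] g μ → AEStronglyMeasurable[m] h μ →
      (∀ᵐ ω ∂μ, |g ω| ≤ R) → (∀ᵐ ω ∂μ, |h ω| ≤ R) → Integrable (fun ω => g ω * h ω) μ := by
    intro g h hg hh hgb hhb
    refine Integrable.of_bound (C := R * R) (hg.mul hh) ?_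
    filter_upwards [hgb, hhb] with ω h1 h2
    rw [norm_mul, Real.norm_eq_abs, Real.norm_eq_abs]
    exact mul_le_mul h1 h2 (abs_nonneg _) ((abs_nonneg _).trans h1)
  have h1 := hprod hmℋ hmℋ hbℋ hbℋ
  have h2 := hprod hm𝒢 hm𝒢 hb𝒢 hb𝒢
  have h3 := hprod hm𝒢 hmℋ hb𝒢 hbℋ
  have h4 : ∫ ω, (μ[f | 𝒢]) ω * (μ[f | ℋ]) ω ∂μ = ∫ ω, (μ[f | 𝒢]) ω * (μ[f | 𝒢]) ω ∂μ := by
    have e1 := condExp_mul_of_stronglyMeasurable_left (m := 𝒢) (μ := μ) (f := μ[f | 𝒢])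
      (g := μ[f | ℋ]) stronglyMeasurable_condExp h3 integrable_condExp
    have e2 := condExp_condExp_of_le (μ := μ) (f := f) h𝒢ℋ hℋ
    rw [show (∫ ω, (μ[f | 𝒢]) ω * (μ[f | ℋ]) ω ∂μ) = ∫ ω, (μ[f | 𝒢] * μ[f | ℋ]) ω ∂μ from rfl,
      ← integral_condExp (h𝒢ℋ.trans hℋ)]
    refine integral_congr_ae ?_
    filter_upwards [e1, e2] with ω w1 w2
    rw [w1, Pi.mul_apply, w2]
  have e : ∀ ω, ((μ[f | ℋ]) ω - (μ[f | 𝒢]) ω) ^ 2 = (μ[f | ℋ]) ω * (μ[f | ℋ]) ω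
      - 2 * ((μ[f | 𝒢]) ω * (μ[f | ℋ]) ω) + (μ[f | 𝒢]) ω * (μ[f | 𝒢]) ω := fun ω => by ring
  have h5 : Integrable (fun ω => (μ[f | ℋ]) ω * (μ[f | ℋ]) ω
      - 2 * ((μ[f | 𝒢]) ω * (μ[f | ℋ]) ω)) μ := h1.sub (h3.const_mul 2)
  simp_rw [e]
  rw [integral_add h5 h2, integral_sub h1 (h3.const_mul 2), integral_const_mul, h4]
  simp_rw [sq]
  ring

theorem lintegral_enorm_le_of_integral_sq_le [IsProbabilityMeasure μ] {u : Ω → ℝ}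
    (hu : Integrable (fun ω => u ω ^ 2) μ) {ε : ℝ} (hε : 0 < ε)
    (h : ∫ ω, u ω ^ 2 ∂μ ≤ (ε / 2) ^ 2) : ∫⁻ ω, ‖u ω‖ₑ ∂μ ≤ ENNReal.ofReal ε := by
  -- A pointwise quadratic bound takes the place of the Cauchy–Schwarz inequality; each of the two
  -- terms integrates to at most `ε / 2`.
  have hp : ∀ ω, ‖u ω‖ₑ ≤ ENNReal.ofReal (ε / 2 + u ω ^ 2 / (ε / 2)) := fun ω => by
    rw [Real.enorm_eq_ofReal_abs]
    refine ENNReal.ofReal_le_ofReal ?_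
    have h3 : ε / 2 + u ω ^ 2 / (ε / 2) - |u ω| =
        ((|u ω| - ε / 4) ^ 2 + 3 / 16 * ε ^ 2) / (ε / 2) := by
      rw [← sq_abs]; field_simp; ring
    have h4 : 0 ≤ ((|u ω| - ε / 4) ^ 2 + 3 / 16 * ε ^ 2) / (ε / 2) := by positivity
    linarith
  have hi : Integrable (fun ω => ε / 2 + u ω ^ 2 / (ε / 2)) μ :=
    (integrable_const _).add (hu.div_const _)
  refine (lintegral_mono hp).trans ?_
  rw [← ofReal_integral_eq_lintegral_ofReal hi (ae_of_all _ fun ω => by positivity)]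
  refine ENNReal.ofReal_le_ofReal ?_
  rw [integral_add (integrable_const _) (hu.div_const _), integral_div (ε / 2) fun ω => u ω ^ 2]
  have : (∫ ω, u ω ^ 2 ∂μ) / (ε / 2) ≤ ε / 2 := by
    rw [div_le_iff₀ (by positivity), ← sq]; exact h
  simp only [integral_const, probReal_univ, smul_eq_mul, one_mul]
  linarith

/-- The second moments decrease along the sequence, hence converge, and by orthogonality their
differences are the squared `L²` distances. -/
theorem cauchy_condExp_of_bounded [IsProbabilityMeasure μ] {𝒢 : ℕ → MeasurableSpace Ω}
    (h𝒢 : Antitone 𝒢) (hm : ∀ n, 𝒢 n ≤ m) {f : Ω → ℝ} {R : ℝ} (hb : ∀ ω, |f ω| ≤ R)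
    {ε : ℝ} (hε : 0 < ε) :
    ∃ J, ∀ i ≥ J, ∀ j ≥ J, ∫⁻ ω, ‖(μ[f | 𝒢 i]) ω - (μ[f | 𝒢 j]) ω‖ₑ ∂μ ≤ ENNReal.ofReal ε := by
  set a : ℕ → ℝ := fun n => ∫ ω, ((μ[f | 𝒢 n]) ω) ^ 2 ∂μ with ha
  have hdiff : ∀ i j, i ≤ j →
      ∫ ω, ((μ[f | 𝒢 i]) ω - (μ[f | 𝒢 j]) ω) ^ 2 ∂μ = a i - a j := fun i j hij =>
    integral_sq_condExp_sub (h𝒢 hij) (hm i) hb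
  have ha_anti : Antitone a := fun i j hij => by
    have h := hdiff i j hij
    have h' : 0 ≤ ∫ ω, ((μ[f | 𝒢 i]) ω - (μ[f | 𝒢 j]) ω) ^ 2 ∂μ :=
      integral_nonneg fun _ => sq_nonneg _
    linarith
  have ha_bdd : BddBelow (Set.range a) :=
    ⟨0, by rintro _ ⟨n, rfl⟩; exact integral_nonneg fun _ => sq_nonneg _⟩
  have hc : CauchySeq a := (tendsto_atTop_ciInf ha_anti ha_bdd).cauchySeq
  obtain ⟨J, hJ⟩ := Metric.cauchySeq_iff.1 hc ((ε / 2) ^ 2) (by positivity)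
  have key : ∀ i ≥ J, ∀ j ≥ i,
      ∫⁻ ω, ‖(μ[f | 𝒢 i]) ω - (μ[f | 𝒢 j]) ω‖ₑ ∂μ ≤ ENNReal.ofReal ε := by
    intro i hi j hj
    refine lintegral_enorm_le_of_integral_sq_le ?_ hε ?_
    · have hbi : ∀ᵐ ω ∂μ, |(μ[f | 𝒢 i]) ω| ≤ R := ae_bdd_abs_condExp_of_ae_bdd_abs (ae_of_all _ hb)
      have hbj : ∀ᵐ ω ∂μ, |(μ[f | 𝒢 j]) ω| ≤ R := ae_bdd_abs_condExp_of_ae_bdd_abs (ae_of_all _ hb)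
      refine Integrable.of_bound (C := (R + R) ^ 2) ?_ ?_
      · exact (((stronglyMeasurable_condExp.mono (hm i)).sub
          (stronglyMeasurable_condExp.mono (hm j))).pow 2).aestronglyMeasurable
      · filter_upwards [hbi, hbj] with ω h1 h2
        rw [norm_pow, Real.norm_eq_abs]
        exact pow_le_pow_left₀ (abs_nonneg _) ((abs_sub _ _).trans (add_le_add h1 h2)) 2
    · rw [hdiff i j hj]
      have := hJ i hi j (hi.le.trans hj)
      rw [Real.dist_eq] at this
      exact (le_abs_self _).trans this.le
  refine ⟨J, fun i hi j hj => ?_⟩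
  rcases le_total i j with h | h
  · exact key i hi j h
  · refine le_trans (le_of_eq ?_) (key j hj i h)
    refine lintegral_congr fun ω => ?_
    rw [← enorm_neg, neg_sub]

theorem lintegral_enorm_condExp_sub_le {𝒢 : MeasurableSpace Ω}
    {f g : Ω → ℝ} (hf : Integrable f μ) (hg : Integrable g μ) :
    ∫⁻ ω, ‖(μ[f | 𝒢]) ω - (μ[g | 𝒢]) ω‖ₑ ∂μ ≤ ∫⁻ ω, ‖f ω - g ω‖ₑ ∂μ := by
  have h1 := eLpNorm_condExp_le_eLpNorm (m := 𝒢) (μ := μ) (f - g) le_rfl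
  rw [eLpNorm_one_eq_lintegral_enorm, eLpNorm_one_eq_lintegral_enorm] at h1
  refine le_trans (le_of_eq (lintegral_congr_ae ?_)) h1
  filter_upwards [condExp_sub hf hg 𝒢] with ω hω
  rw [hω, Pi.sub_apply]

/-- Conditional expectations of an integrable function along a decreasing sequence of sigma-fields
form a Cauchy sequence in `L¹`. -/
theorem cauchy_condExp [IsProbabilityMeasure μ] {𝒢 : ℕ → MeasurableSpace Ω}
    (h𝒢 : Antitone 𝒢) (hm : ∀ n, 𝒢 n ≤ m) {f : Ω → ℝ} (hf : Integrable f μ)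
    {ε : ℝ} (hε : 0 < ε) :
    ∃ J, ∀ i ≥ J, ∀ j ≥ J, ∫⁻ ω, ‖(μ[f | 𝒢 i]) ω - (μ[f | 𝒢 j]) ω‖ₑ ∂μ ≤ ENNReal.ofReal ε := by
  have hδ : ENNReal.ofReal (ε / 3) ≠ 0 := by
    rw [Ne, ENNReal.ofReal_eq_zero, not_le]; positivity
  obtain ⟨g, hg, hgL⟩ := (memLp_one_iff_integrable.2 hf).exists_simpleFunc_eLpNorm_sub_lt
    ENNReal.one_ne_top hδ
  have hgi : Integrable (⇑g) μ := memLp_one_iff_integrable.1 hgL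
  rw [eLpNorm_one_eq_lintegral_enorm] at hg
  obtain ⟨R, hR⟩ := g.exists_forall_norm_le
  obtain ⟨J, hJ⟩ := cauchy_condExp_of_bounded (μ := μ) h𝒢 hm (f := g) (R := R) hR
    (ε := ε / 3) (by positivity)
  refine ⟨J, fun i hi j hj => ?_⟩
  have hmm : ∀ n, Measurable (μ[f | 𝒢 n]) := fun n =>
    (stronglyMeasurable_condExp.mono (hm n)).measurable
  have hmg : ∀ n, Measurable (μ[⇑g | 𝒢 n]) := fun n =>
    (stronglyMeasurable_condExp.mono (hm n)).measurable
  have hE : ∀ {u v : Ω → ℝ}, Measurable u → Measurable v → Measurable fun ω => ‖u ω - v ω‖ₑ :=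
    fun hu hv => (hu.sub hv).enorm
  have hp : ∀ ω, ‖(μ[f | 𝒢 i]) ω - (μ[f | 𝒢 j]) ω‖ₑ ≤ ‖(μ[f | 𝒢 i]) ω - (μ[⇑g | 𝒢 i]) ω‖ₑ
      + ‖(μ[⇑g | 𝒢 i]) ω - (μ[⇑g | 𝒢 j]) ω‖ₑ + ‖(μ[f | 𝒢 j]) ω - (μ[⇑g | 𝒢 j]) ω‖ₑ := fun ω => by
    rw [← enorm_neg ((μ[f | 𝒢 j]) ω - (μ[⇑g | 𝒢 j]) ω)]
    refine le_trans (le_of_eq ?_) ((enorm_add_le _ _).trans (add_le_add_left (enorm_add_le _ _) _))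
    congr 1; ring
  have hfg : ∫⁻ ω, ‖f ω - g ω‖ₑ ∂μ ≤ ENNReal.ofReal (ε / 3) := hg.le
  calc _ ≤ _ := lintegral_mono hp
    _ = ∫⁻ ω, ‖(μ[f | 𝒢 i]) ω - (μ[⇑g | 𝒢 i]) ω‖ₑ ∂μ
      + ∫⁻ ω, ‖(μ[⇑g | 𝒢 i]) ω - (μ[⇑g | 𝒢 j]) ω‖ₑ ∂μ
      + ∫⁻ ω, ‖(μ[f | 𝒢 j]) ω - (μ[⇑g | 𝒢 j]) ω‖ₑ ∂μ := by
        rw [lintegral_add_right _ (hE (hmm j) (hmg j)),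
          lintegral_add_right _ (hE (hmg i) (hmg j))]
    _ ≤ ENNReal.ofReal (ε / 3) + ENNReal.ofReal (ε / 3) + ENNReal.ofReal (ε / 3) := by
        gcongr
        · exact (lintegral_enorm_condExp_sub_le hf hgi).trans hfg
        · exact hJ i hi j hj
        · exact (lintegral_enorm_condExp_sub_le hf hgi).trans hfg
    _ = ENNReal.ofReal ε := by
        rw [← ENNReal.ofReal_add (by positivity) (by positivity),
          ← ENNReal.ofReal_add (by positivity) (by positivity)]
        congr 1; ring

end Decreasing


/-! ### Conditional expectations that are measurable in the probability measure -/

section CondExp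

/-- `Y` is the Radon–Nikodym derivative of the image under `φ` of the measure `X p · κ p` with
respect to the image of `κ p`. Countable generation of the target makes this derivative jointly
measurable. Taking for `φ` the identity into a smaller sigma-field gives a conditional expectation.
-/
theorem exists_measurable_density {𝔓 Ω Ω' : Type*} [MeasurableSpace 𝔓] [MeasurableSpace Ω]
    [MeasurableSpace Ω'] [MeasurableSpace.CountablyGenerated Ω'] (κ : Kernel 𝔓 Ω)
    [IsMarkovKernel κ] {φ : Ω → Ω'} (hφ : Measurable φ) {X : 𝔓 → Ω → ℝ≥0∞}
    (hX : Measurable (fun q : 𝔓 × Ω => X q.1 q.2)) (hfin : ∀ p, ∫⁻ ω, X p ω ∂κ p ≠ ∞) :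
    ∃ Y : 𝔓 → Ω' → ℝ≥0∞, Measurable (fun q : 𝔓 × Ω' => Y q.1 q.2) ∧
      ∀ p B, MeasurableSet B →
        ∫⁻ ω in φ ⁻¹' B, Y p (φ ω) ∂κ p = ∫⁻ ω in φ ⁻¹' B, X p ω ∂κ p := by
  have hXp : ∀ p, Measurable (X p) := fun p => hX.comp measurable_prodMk_left
  -- A finite kernel needs a bound on the mass that is uniform in `p`. Division by `c p` gives mass
  -- at most `1`; the summand `1` keeps `c p` away from zero.
  set c : 𝔓 → ℝ≥0∞ := fun p => 1 + ∫⁻ ω, X p ω ∂κ p with hc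
  have hc_meas : Measurable c := measurable_const.add hX.lintegral_kernel_prod_right'
  have hc0 : ∀ p, c p ≠ 0 := fun p => by simp [hc]
  have hct : ∀ p, c p ≠ ∞ := fun p => by simp [hc, hfin p]
  set X' : 𝔓 → Ω → ℝ≥0∞ := fun p ω => (c p)⁻¹ * X p ω with hX'
  have hX'm : Measurable (Function.uncurry X') := (hc_meas.comp measurable_fst).inv.mul hX
  set η : Kernel 𝔓 Ω := κ.withDensity X' with hη
  have hηa : ∀ p, η p = (κ p).withDensity (X' p) := fun p => Kernel.withDensity_apply κ hX'm p
  have : IsFiniteKernel η := by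
    refine ⟨1, ENNReal.one_lt_top, fun p => ?_⟩
    rw [hηa, withDensity_apply _ MeasurableSet.univ, Measure.restrict_univ]
    simp only [hX']
    rw [lintegral_const_mul _ (hXp p)]
    calc (c p)⁻¹ * ∫⁻ ω, X p ω ∂κ p ≤ (c p)⁻¹ * c p := by
          gcongr; exact le_add_self
      _ = 1 := ENNReal.inv_mul_cancel (hc0 p) (hct p)
  have hac : ∀ p, (η.map φ) p ≪ (κ.map φ) p := fun p => by
    rw [Kernel.map_apply _ hφ, Kernel.map_apply _ hφ, hηa]
    exact (withDensity_absolutelyContinuous _ _).map hφ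
  have hD : Measurable (fun q : 𝔓 × Ω' => Kernel.rnDeriv (η.map φ) (κ.map φ) q.1 q.2) :=
    Kernel.measurable_rnDeriv _ _
  refine ⟨fun p ω' => c p * Kernel.rnDeriv (η.map φ) (κ.map φ) p ω',
    (hc_meas.comp measurable_fst).mul hD, fun p B hB => ?_⟩
  have hDp : Measurable (fun ω' => Kernel.rnDeriv (η.map φ) (κ.map φ) p ω') :=
    hD.comp measurable_prodMk_left
  have h1 : ∫⁻ ω' in B, Kernel.rnDeriv (η.map φ) (κ.map φ) p ω' ∂(κ.map φ) p
      = (η.map φ) p B := by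
    have h := Kernel.withDensity_rnDeriv_eq (hac p)
    rw [Kernel.withDensity_apply _ hD] at h
    rw [← withDensity_apply _ hB, h]
  rw [Kernel.map_apply _ hφ, Kernel.map_apply _ hφ, Measure.map_apply hφ hB, hηa,
    withDensity_apply _ (hφ hB), setLIntegral_map hB hDp hφ] at h1
  have hDφ : Measurable (fun ω => Kernel.rnDeriv (η.map φ) (κ.map φ) p (φ ω)) := hDp.comp hφ
  beta_reduce
  rw [lintegral_const_mul _ hDφ, h1]
  simp only [hX']
  rw [lintegral_const_mul _ (hXp p), ← mul_assoc,
    ENNReal.mul_inv_cancel (hc0 p) (hct p), one_mul]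

theorem exists_measurable_density_real {𝔓 Ω Ω' : Type*} [MeasurableSpace 𝔓] [MeasurableSpace Ω]
    [MeasurableSpace Ω'] [MeasurableSpace.CountablyGenerated Ω'] (κ : Kernel 𝔓 Ω)
    [IsMarkovKernel κ] {φ : Ω → Ω'} (hφ : Measurable φ) {X : 𝔓 → Ω → ℝ}
    (hX : Measurable (fun q : 𝔓 × Ω => X q.1 q.2)) (hi : ∀ p, Integrable (X p) (κ p)) :
    ∃ Y : 𝔓 → Ω' → ℝ, Measurable (fun q : 𝔓 × Ω' => Y q.1 q.2) ∧
      (∀ p, Integrable (fun ω => Y p (φ ω)) (κ p)) ∧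
      ∀ p B, MeasurableSet B →
        ∫ ω in φ ⁻¹' B, Y p (φ ω) ∂κ p = ∫ ω in φ ⁻¹' B, X p ω ∂κ p := by
  have key : ∀ Z : 𝔓 → Ω → ℝ, Measurable (fun q : 𝔓 × Ω => Z q.1 q.2) →
      (∀ p, Integrable (Z p) (κ p)) → (∀ p ω, 0 ≤ Z p ω) →
      ∃ Y : 𝔓 → Ω' → ℝ, Measurable (fun q : 𝔓 × Ω' => Y q.1 q.2) ∧
      (∀ p, Integrable (fun ω => Y p (φ ω)) (κ p)) ∧
      ∀ p B, MeasurableSet B →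
        ∫ ω in φ ⁻¹' B, Y p (φ ω) ∂κ p = ∫ ω in φ ⁻¹' B, Z p ω ∂κ p := by
    intro Z hZ hZi hZ0
    have hfin : ∀ p, ∫⁻ ω, ENNReal.ofReal (Z p ω) ∂κ p ≠ ∞ := fun p =>
      ((hasFiniteIntegral_iff_ofReal (ae_of_all _ (hZ0 p))).1 (hZi p).hasFiniteIntegral).ne
    obtain ⟨Y, hY, hYe⟩ := exists_measurable_density κ hφ (X := fun p ω => ENNReal.ofReal (Z p ω))
      hZ.ennreal_ofReal hfin
    have hYp : ∀ p, Measurable (fun ω => Y p (φ ω)) := fun p =>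
      (hY.comp measurable_prodMk_left).comp hφ
    have hYfin : ∀ p, ∫⁻ ω, Y p (φ ω) ∂κ p ≠ ∞ := fun p => by
      have h := hYe p Set.univ MeasurableSet.univ
      simp only [Set.preimage_univ, Measure.restrict_univ] at h
      rw [h]; exact hfin p
    refine ⟨fun p ω' => (Y p ω').toReal, hY.ennreal_toReal, fun p =>
      integrable_toReal_of_lintegral_ne_top (hYp p).aemeasurable (hYfin p), fun p B hB => ?_⟩
    rw [integral_toReal (hYp p).aemeasurable (ae_restrict_of_ae (ae_lt_top (hYp p) (hYfin p))),
      hYe p B hB, integral_eq_lintegral_of_nonneg_ae (ae_of_all _ (hZ0 p))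
        (hZi p).aestronglyMeasurable.restrict]
  obtain ⟨Y₁, hY₁, hY₁i, hY₁e⟩ := key (fun p ω => max (X p ω) 0) (hX.max measurable_const)
    (fun p => (hi p).pos_part) (fun _ _ => le_max_right _ _)
  obtain ⟨Y₂, hY₂, hY₂i, hY₂e⟩ := key (fun p ω => max (-X p ω) 0) (hX.neg.max measurable_const)
    (fun p => (hi p).neg_part) (fun _ _ => le_max_right _ _)
  refine ⟨fun p ω' => Y₁ p ω' - Y₂ p ω', hY₁.sub hY₂, fun p => (hY₁i p).sub (hY₂i p),
    fun p B hB => ?_⟩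
  rw [integral_sub (hY₁i p).integrableOn (hY₂i p).integrableOn, hY₁e p B hB, hY₂e p B hB,
    ← integral_sub (hi p).pos_part.integrableOn (hi p).neg_part.integrableOn]
  refine integral_congr_ae (ae_of_all _ fun ω => ?_)
  rcases le_total (X p ω) 0 with h | h <;> simp [h]

variable {𝔓 Ω : Type*} [MeasurableSpace 𝔓] [mΩ : MeasurableSpace Ω]

/-- A version of the conditional expectation given a countably generated sigma-field that is
measurable in the probability measure. -/
theorem exists_measurable_condExp (κ : Kernel 𝔓 Ω) [IsMarkovKernel κ] {X : 𝔓 → Ω → ℝ}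
    (hX : Measurable (fun q : 𝔓 × Ω => X q.1 q.2)) (hi : ∀ p, Integrable (X p) (κ p))
    {𝒢 : MeasurableSpace Ω} (h𝒢 : 𝒢 ≤ mΩ) (hcg : @MeasurableSpace.CountablyGenerated Ω 𝒢) :
    ∃ Y : 𝔓 → Ω → ℝ, Measurable[Prod.instMeasurableSpace (m₂ := mΩ)] (fun q : 𝔓 × Ω => Y q.1 q.2) ∧
      (∀ p, Measurable[𝒢] (Y p)) ∧ ∀ p, Y p =ᵐ[κ p] (κ p)[X p | 𝒢] := by
  obtain ⟨Y, hY, hYi, hYe⟩ := @exists_measurable_density_real 𝔓 Ω Ω _ mΩ 𝒢 hcg κ _ id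
    (measurable_id'' h𝒢) X hX hi
  refine ⟨Y, ?_, fun p => ?_, fun p => ?_⟩
  · exact hY.mono (sup_le_sup le_rfl (MeasurableSpace.comap_mono h𝒢)) le_rfl
  · exact @Measurable.comp _ _ _ 𝒢 (Prod.instMeasurableSpace (m₂ := 𝒢)) _ _ _ hY
      (@measurable_prodMk_left _ _ _ 𝒢 p)
  · refine ae_eq_condExp_of_forall_setIntegral_eq h𝒢 (hi p) (fun _ _ _ => (hYi p).integrableOn)
      (fun B hB _ => hYe p B hB) ?_
    refine (Measurable.stronglyMeasurable ?_).aestronglyMeasurable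
    exact @Measurable.comp _ _ _ 𝒢 (Prod.instMeasurableSpace (m₂ := 𝒢)) _ _ _ hY
      (@measurable_prodMk_left _ _ _ 𝒢 p)

/-- A version of the conditional expectation given the intersection of a decreasing sequence of
countably generated sigma-fields that is measurable in the probability measure. -/
theorem exists_measurable_condExp_iInf (κ : Kernel 𝔓 Ω) [IsMarkovKernel κ] {X : 𝔓 → Ω → ℝ}
    (hX : Measurable (fun q : 𝔓 × Ω => X q.1 q.2)) (hi : ∀ p, Integrable (X p) (κ p))
    {𝒢 : ℕ → MeasurableSpace Ω} (h𝒢 : ∀ n, 𝒢 n ≤ mΩ) (hanti : Antitone 𝒢)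
    (hcg : ∀ n, @MeasurableSpace.CountablyGenerated Ω (𝒢 n)) :
    ∃ Y : 𝔓 → Ω → ℝ, Measurable (fun q : 𝔓 × Ω => Y q.1 q.2) ∧
      (∀ p, Measurable[⨅ n, 𝒢 n] (Y p)) ∧ (∀ p, Integrable (Y p) (κ p)) ∧
      ∀ p B, MeasurableSet[⨅ n, 𝒢 n] B → ∫ ω in B, Y p ω ∂κ p = ∫ ω in B, X p ω ∂κ p := by
  choose Z hZ hZm hZe using fun n => exists_measurable_condExp κ hX hi (h𝒢 n) (hcg n)
  obtain ⟨j, hj, hkj, hdist⟩ := exists_measurable_subseq κ hZ fun p ε hε => by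
    obtain ⟨J, hJ⟩ := cauchy_condExp (μ := κ p) hanti h𝒢 (hi p) hε
    refine ⟨J, fun i hi' j hj' => le_trans (le_of_eq (lintegral_congr_ae ?_)) (hJ i hi' j hj')⟩
    filter_upwards [hZe i p, hZe j p] with ω h1 h2
    rw [h1, h2]
  set W : ℕ → 𝔓 → Ω → ℝ := fun k p ω => Z (j k p) p ω with hW
  have hWm : ∀ k, Measurable (fun q : 𝔓 × Ω => W k q.1 q.2) := fun k =>
    measurable_comp_countable hZ (hj k)
  have hWp : ∀ p k, Measurable (W k p) := fun p k => (hWm k).comp measurable_prodMk_left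
  have hWi : ∀ p k, Integrable (W k p) (κ p) := fun p k =>
    (integrable_condExp (m := 𝒢 (j k p)) (μ := κ p) (f := X p)).congr (hZe (j k p) p).symm
  have hsum : ∀ p, ∑' k, ∫⁻ ω, ‖W (k + 1) p ω - W k p ω‖ₑ ∂κ p ≠ ∞ := fun p =>
    ne_top_of_le_ne_top tsum_ofReal_half_pow_ne_top (ENNReal.tsum_le_tsum fun k => hdist k p)
  -- The upper limit in `EReal` is defined at every point and is jointly measurable; it is the true
  -- limit almost surely.
  set Y : 𝔓 → Ω → ℝ := fun p ω => (limsup (fun k => (W k p ω : EReal)) atTop).toReal with hY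
  have hlim : ∀ p, ∀ᵐ ω ∂κ p, Tendsto (fun k => W k p ω) atTop (𝓝 (Y p ω)) := fun p => by
    filter_upwards [ae_exists_tendsto_of_tsum (hWp p) (hsum p)] with ω ⟨y, hy⟩
    have h1 : Tendsto (fun k => (W k p ω : EReal)) atTop (𝓝 (y : EReal)) :=
      (continuous_coe_real_ereal.tendsto y).comp hy
    have h2 : Y p ω = y := by simp only [hY]; rw [h1.limsup_eq, EReal.toReal_coe]
    rwa [h2]
  set H : 𝔓 → Ω → ℝ≥0∞ := fun p ω => ‖W 0 p ω‖ₑ + ∑' i, ‖W (i + 1) p ω - W i p ω‖ₑ with hH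
  have hHm : ∀ p, Measurable (H p) := fun p =>
    (hWp p 0).enorm.add (Measurable.tsum (measurable_enorm_sub (hWp p)))
  have hHfin : ∀ p, ∫⁻ ω, H p ω ∂κ p ≠ ∞ := fun p =>
    lintegral_add_tsum_ne_top (hWp p) (hWi p 0).hasFiniteIntegral.ne (hsum p)
  have hHi : ∀ p, Integrable (fun ω => (H p ω).toReal) (κ p) := fun p =>
    integrable_toReal_of_lintegral_ne_top (hHm p).aemeasurable (hHfin p)
  have hbound : ∀ p k, ∀ᵐ ω ∂κ p, ‖W k p ω‖ ≤ (H p ω).toReal := fun p k => by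
    filter_upwards [ae_lt_top (hHm p) (hHfin p)] with ω hω
    rw [← toReal_enorm]
    exact ENNReal.toReal_mono hω.ne (enorm_le_add_tsum (h := fun k => W k p ω) k)
  have hYm : Measurable (fun q : 𝔓 × Ω => Y q.1 q.2) :=
    (Measurable.limsup fun k => measurable_coe_real_ereal.comp (hWm k)).ereal_toReal
  refine ⟨Y, hYm, fun p => ?_, fun p => ?_, fun p B hB => ?_⟩
  · rw [measurable_iff_comap_le, le_iInf_iff]
    intro n
    rw [← measurable_iff_comap_le]
    -- An upper limit ignores finitely many terms, and those from index `n` on are measurable for `𝒢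
    -- n` because `n ≤ j (k + n) p`. This holds for every `n`, without any null set.
    have e : Y p = fun ω => (limsup (fun k => (W (k + n) p ω : EReal)) atTop).toReal := by
      funext ω
      simp only [hY]
      rw [Filter.limsup_nat_add (fun k => (W k p ω : EReal)) n]
    rw [e]
    refine @Measurable.ereal_toReal _ (𝒢 n) _ (@Measurable.limsup _ _ _ _ _ (𝒢 n) _ _ _ _ fun k => ?_)
    refine measurable_coe_real_ereal.comp ((hZm (j (k + n) p) p).mono (hanti ?_) le_rfl)
    exact (Nat.le_add_left n k).trans (hkj (k + n) p)
  · refine (hHi p).mono' (hYm.comp measurable_prodMk_left).aestronglyMeasurable ?_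
    filter_upwards [hlim p, ae_all_iff.2 (hbound p)] with ω h1 h2
    exact le_of_tendsto h1.norm (Eventually.of_forall h2)
  · have h1 : Tendsto (fun k => ∫ ω in B, W k p ω ∂κ p) atTop (𝓝 (∫ ω in B, Y p ω ∂κ p)) :=
      tendsto_integral_of_dominated_convergence (fun ω => (H p ω).toReal)
        (fun k => (hWp p k).aestronglyMeasurable) (hHi p).integrableOn
        (fun k => ae_restrict_of_ae (hbound p k)) (ae_restrict_of_ae (hlim p))
    refine tendsto_nhds_unique h1 (tendsto_const_nhds.congr fun k => ?_)
    have h2 : MeasurableSet[𝒢 (j k p)] B := (iInf_le 𝒢 (j k p)) B hB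
    rw [← setIntegral_condExp (h𝒢 (j k p)) (hi p) h2]
    exact integral_congr_ae (ae_restrict_of_ae (hZe (j k p) p).symm)

end CondExp


/-! ### Dyadic grids -/

/-- The points of the dyadic grid of mesh `2⁻ⁿ`. -/
noncomputable def grid (n l : ℕ) : ℝ≥0 := l / 2 ^ n

theorem grid_mono (n : ℕ) : Monotone (grid n) := fun _ _ h => by
  unfold grid; gcongr

@[simp] theorem grid_zero_right (n : ℕ) : grid n 0 = 0 := by simp [grid]

theorem grid_zero_left (l : ℕ) : grid 0 l = l := by simp [grid]

theorem grid_eq_grid_add (n m l : ℕ) : grid n l = grid (n + m) (l * 2 ^ m) := by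
  unfold grid
  push_cast
  rw [pow_add, mul_div_mul_right _ _ (by positivity)]

theorem exists_grid_eq {n m : ℕ} (h : n ≤ m) (l : ℕ) : grid n l = grid m (l * 2 ^ (m - n)) := by
  rw [grid_eq_grid_add n (m - n), Nat.add_sub_cancel' h]

theorem ceil_grid_mul (n l : ℕ) : ⌈grid n l * 2 ^ n⌉₊ = l := by
  rw [grid, div_mul_cancel₀ _ (by positivity), Nat.ceil_natCast]

theorem lt_ceil_mul_iff {n l : ℕ} {t : ℝ≥0} : l < ⌈t * 2 ^ n⌉₊ ↔ grid n l < t := by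
  rw [Nat.lt_ceil, grid, div_lt_iff₀ (by positivity)]

theorem le_grid_ceil (n : ℕ) (t : ℝ≥0) : t ≤ grid n ⌈t * 2 ^ n⌉₊ := by
  rw [grid, le_div_iff₀ (by positivity)]
  exact Nat.le_ceil _

theorem grid_le_iff {n l : ℕ} {t : ℝ≥0} : grid n l ≤ t ↔ l ≤ ⌊t * 2 ^ n⌋₊ := by
  rw [Nat.le_floor_iff zero_le, grid, div_le_iff₀ (by positivity)]

theorem exists_grid_between {s t : ℝ≥0} (h : s < t) : ∃ n l, s < grid n l ∧ grid n l < t := by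
  have hst : (0 : ℝ≥0) < t - s := tsub_pos_of_lt h
  obtain ⟨n, hn⟩ := exists_pow_lt_of_lt_one hst (by rw [← NNReal.coe_lt_coe]; norm_num : (1 / 2 : ℝ≥0) < 1)
  refine ⟨n, ⌊s * 2 ^ n⌋₊ + 1, ?_, ?_⟩
  · rw [grid, lt_div_iff₀ (by positivity)]
    push_cast
    exact Nat.lt_floor_add_one _
  · have h1 : grid n ⌊s * 2 ^ n⌋₊ ≤ s := grid_le_iff.2 le_rfl
    have h2 : grid n (⌊s * 2 ^ n⌋₊ + 1) = grid n ⌊s * 2 ^ n⌋₊ + (1 / 2) ^ n := by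
      unfold grid; push_cast; rw [add_div, one_div_pow]
    rw [h2]
    calc _ ≤ s + (1 / 2) ^ n := by gcongr
      _ < s + (t - s) := by gcongr
      _ = t := add_tsub_cancel_of_le h.le

/-! ### Stopping indices on a dyadic grid and optional sampling. -/

section Stopping

variable {Ω : Type*} {m : MeasurableSpace Ω} {μ : Measure Ω}

theorem isStoppingTime_grid {𝓕 : Filtration ℝ≥0 m} {n : ℕ} {ρ : Ω → ℕ}
    (hρ : ∀ l, MeasurableSet[𝓕.rightCont (grid n l)] {ω | l < ρ ω}) :
    IsStoppingTime (usualAugmentation 𝓕 μ) (fun ω => ((grid n (ρ ω) : ℝ≥0) : WithTop ℝ≥0)) := by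
  intro t
  have h : {ω | ((grid n (ρ ω) : ℝ≥0) : WithTop ℝ≥0) ≤ (t : WithTop ℝ≥0)}
      = {ω | ⌊t * 2 ^ n⌋₊ < ρ ω}ᶜ := by
    ext ω
    simp only [Set.mem_ofPred_eq, WithTop.coe_le_coe, Set.mem_compl_iff, not_lt]
    exact grid_le_iff
  rw [h]
  have h1 : 𝓕.rightCont (grid n ⌊t * 2 ^ n⌋₊) ≤ usualAugmentation 𝓕 μ t :=
    (𝓕.rightCont.mono (grid_le_iff.2 le_rfl)).trans le_sup_left
  exact (h1 _ (hρ _)).compl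

/-- Telescoping up to a bounded random index. -/
theorem eq_add_sum_indicator {x : ℕ → Ω → ℝ} {ρ : Ω → ℕ} {J : ℕ} (hJ : ∀ ω, ρ ω ≤ J) (ω : Ω) :
    x (ρ ω) ω = x 0 ω
      + ∑ l ∈ Finset.range J, {ω | l < ρ ω}.indicator (fun ω => x (l + 1) ω - x l ω) ω := by
  have h : ∑ l ∈ Finset.range J, {ω | l < ρ ω}.indicator (fun ω => x (l + 1) ω - x l ω) ω
      = ∑ l ∈ Finset.range (ρ ω), (x (l + 1) ω - x l ω) := by
    simp only [Set.indicator_apply, Set.mem_ofPred_eq]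
    rw [← Finset.sum_filter]
    congr 1
    ext l
    simp only [Finset.mem_filter, Finset.mem_range]
    exact ⟨fun h => h.2, fun h => ⟨h.trans_le (hJ ω), h⟩⟩
  rw [h, Finset.sum_range_sub (fun l => x l ω)]
  ring

theorem integrable_stopped {x : ℕ → Ω → ℝ} (hx : ∀ l, Integrable (x l) μ) {ρ : Ω → ℕ} {J : ℕ}
    (hJ : ∀ ω, ρ ω ≤ J) (hρ : ∀ l, MeasurableSet {ω | l < ρ ω}) :
    Integrable (fun ω => x (ρ ω) ω) μ := by
  simp_rw [eq_add_sum_indicator (x := x) hJ]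
  exact (hx 0).add (integrable_finsetSum _ fun l _ => ((hx (l + 1)).sub (hx l)).indicator (hρ l))

theorem integral_stopped {x : ℕ → Ω → ℝ} (hx : ∀ l, Integrable (x l) μ) {ρ : Ω → ℕ} {J : ℕ}
    (hJ : ∀ ω, ρ ω ≤ J) (hρ : ∀ l, MeasurableSet {ω | l < ρ ω}) :
    ∫ ω, x (ρ ω) ω ∂μ = ∫ ω, x 0 ω ∂μ
      + ∑ l ∈ Finset.range J, ∫ ω in {ω | l < ρ ω}, (x (l + 1) ω - x l ω) ∂μ := by
  have hi : ∀ l, Integrable ({ω | l < ρ ω}.indicator (fun ω => x (l + 1) ω - x l ω)) μ :=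
    fun l => ((hx (l + 1)).sub (hx l)).indicator (hρ l)
  simp_rw [eq_add_sum_indicator (x := x) hJ]
  rw [integral_add (hx 0) (integrable_finsetSum _ fun l _ => hi l),
    integral_finsetSum _ fun l _ => hi l]
  congr 1
  exact Finset.sum_congr rfl fun l _ => integral_indicator (hρ l)

end Stopping

/-! ### Discrete compensators -/

section Compensator

variable {Ω : Type*} {m : MeasurableSpace Ω} {μ : Measure Ω}

/-- `a n l` is a nonnegative version of the conditional expectation of the increment of `S` over the
`l`-th interval of the dyadic grid of mesh `2⁻ⁿ`, given the past. -/
structure IsCompensator (𝓕 : Filtration ℝ≥0 m) (μ : Measure Ω) (S : ℝ≥0 → Ω → ℝ)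
    (a : ℕ → ℕ → Ω → ℝ) : Prop where
  nonneg : ∀ n l ω, 0 ≤ a n l ω
  measurable : ∀ n l, Measurable[𝓕.rightCont (grid n l)] (a n l)
  integrable : ∀ n l, Integrable (a n l) μ
  setIntegral : ∀ n l B, MeasurableSet[𝓕.rightCont (grid n l)] B →
    ∫ ω in B, a n l ω ∂μ = ∫ ω in B, (S (grid n (l + 1)) ω - S (grid n l) ω) ∂μ

/-- Partial sums of the compensators along a dyadic grid. -/
noncomputable def discreteSum (a : ℕ → ℕ → Ω → ℝ) (n j : ℕ) (ω : Ω) : ℝ :=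
  ∑ l ∈ Finset.range j, a n l ω

theorem discreteSum_zero (a : ℕ → ℕ → Ω → ℝ) (n : ℕ) (ω : Ω) : discreteSum a n 0 ω = 0 := by
  simp [discreteSum]

theorem discreteSum_succ_sub (a : ℕ → ℕ → Ω → ℝ) (n l : ℕ) (ω : Ω) :
    discreteSum a n (l + 1) ω - discreteSum a n l ω = a n l ω := by
  simp [discreteSum, Finset.sum_range_succ]

variable {𝓕 : Filtration ℝ≥0 m} {S : ℝ≥0 → Ω → ℝ} {a : ℕ → ℕ → Ω → ℝ}

namespace IsCompensator

theorem mono (h : IsCompensator 𝓕 μ S a) (n : ℕ) (ω : Ω) :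
    Monotone (fun j => discreteSum a n j ω) := fun _ _ hij =>
  Finset.sum_le_sum_of_subset_of_nonneg (Finset.range_mono hij) fun l _ _ => h.nonneg n l ω

theorem discreteSum_nonneg (h : IsCompensator 𝓕 μ S a) (n j : ℕ) (ω : Ω) :
    0 ≤ discreteSum a n j ω := Finset.sum_nonneg fun l _ => h.nonneg n l ω

theorem integrable_discreteSum (h : IsCompensator 𝓕 μ S a) (n j : ℕ) :
    Integrable (discreteSum a n j) μ := integrable_finsetSum _ fun l _ => h.integrable n l

theorem measurable_discreteSum (h : IsCompensator 𝓕 μ S a) (n : ℕ) {j k : ℕ} (hjk : j ≤ k + 1) :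
    Measurable[𝓕.rightCont (grid n k)] (discreteSum a n j) := by
  refine Finset.measurable_fun_sum _ fun l hl => (h.measurable n l).mono
    (𝓕.rightCont.mono (grid_mono n ?_)) le_rfl
  have := Finset.mem_range.1 hl
  omega

/-- Optional sampling for the compensated process along a dyadic grid. -/
theorem integral_stopped_eq (h : IsCompensator 𝓕 μ S a) (hS : ∀ t, Integrable (S t) μ) {n J : ℕ}
    {ρ : Ω → ℕ} (hJ : ∀ ω, ρ ω ≤ J)
    (hρ : ∀ l, MeasurableSet[𝓕.rightCont (grid n l)] {ω | l < ρ ω}) :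
    ∫ ω, discreteSum a n (ρ ω) ω ∂μ = ∫ ω, S (grid n (ρ ω)) ω ∂μ - ∫ ω, S 0 ω ∂μ := by
  have hρ' : ∀ l, MeasurableSet {ω | l < ρ ω} := fun l => 𝓕.rightCont.le _ _ (hρ l)
  rw [integral_stopped (x := discreteSum a n) (h.integrable_discreteSum n) hJ hρ',
    integral_stopped (x := fun l => S (grid n l)) (fun l => hS _) hJ hρ']
  simp only [discreteSum_succ_sub, discreteSum_zero, integral_zero, grid_zero_right, zero_add,
    add_sub_cancel_left]
  exact Finset.sum_congr rfl fun l _ => h.setIntegral n l _ (hρ l)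

end IsCompensator

theorem IsClassD.exists_bound (hD : IsClassD S (usualAugmentation 𝓕 μ) μ) :
    ∃ K : ℝ≥0, ∀ t, ∫⁻ ω, ‖S t ω‖ₑ ∂μ ≤ K := by
  obtain ⟨K, hK⟩ := hD.2.2
  refine ⟨K, fun t => ?_⟩
  have h := hK ⟨fun _ => (t : WithTop ℝ≥0), isStoppingTime_const _ t, fun _ => WithTop.coe_ne_top⟩
  rwa [eLpNorm_one_eq_lintegral_enorm] at h

theorem IsClassD.exists_unif (hD : IsClassD S (usualAugmentation 𝓕 μ) μ) {ε : ℝ} (hε : 0 < ε) :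
    ∃ δ : ℝ, 0 < δ ∧ ∀ τ : Ω → ℝ≥0,
      IsStoppingTime (usualAugmentation 𝓕 μ) (fun ω => (τ ω : WithTop ℝ≥0)) →
      ∀ s, MeasurableSet s → μ s ≤ ENNReal.ofReal δ →
        ∫⁻ ω in s, ‖S (τ ω) ω‖ₑ ∂μ ≤ ENNReal.ofReal ε := by
  obtain ⟨δ, hδ, h⟩ := hD.2.1 hε
  refine ⟨δ, hδ, fun τ hτ s hs hμ => ?_⟩
  have h1 := h ⟨fun ω => (τ ω : WithTop ℝ≥0), hτ, fun _ => WithTop.coe_ne_top⟩ s hs hμ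
  rw [eLpNorm_indicator_eq_eLpNorm_restrict hs, eLpNorm_one_eq_lintegral_enorm] at h1
  exact h1

/-- The discrete compensators of a process of class D are uniformly integrable. -/
theorem IsCompensator.exists_excess_le [IsProbabilityMeasure μ] (h : IsCompensator 𝓕 μ S a)
    (hS : ∀ t, Integrable (S t) μ) (hD : IsClassD S (usualAugmentation 𝓕 μ) μ)
    {ε : ℝ} (hε : 0 < ε) :
    ∃ c : ℝ, ∀ n J, ∫⁻ ω, ENNReal.ofReal (discreteSum a n J ω - c) ∂μ ≤ ENNReal.ofReal ε := by
  classical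
  obtain ⟨K, hK⟩ := hD.exists_bound
  obtain ⟨δ, hδ, hunif⟩ := hD.exists_unif (half_pos hε)
  have hSK : ∀ t, |∫ ω, S t ω ∂μ| ≤ K := fun t => by
    have h1 := norm_integral_le_lintegral_norm (μ := μ) (S t)
    have h2 : ∫⁻ ω, ENNReal.ofReal ‖S t ω‖ ∂μ ≤ K := by
      simpa only [ofReal_norm] using hK t
    rw [Real.norm_eq_abs] at h1
    exact h1.trans (ENNReal.toReal_le_coe_of_le_coe h2)
  -- The sum up to `J` has mean at most `2 * K`, so by Markov's inequality it exceeds `c` with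
  -- probability at most `δ`; the summand `1` makes `c` positive.
  set c : ℝ := (2 * K + 1) / δ with hc
  have hcpos : 0 < c := by positivity
  refine ⟨c, fun n J => ?_⟩
  -- The last index before the sum exceeds `c`. Since `a n l` is known at the left end of its
  -- interval, the event `l < ρ` is known at time `grid n l`: one may stop before the jump, without
  -- overshooting `c`.
  set ρ : Ω → ℕ := fun ω => Nat.findGreatest (fun l => discreteSum a n l ω ≤ c) J with hρ
  have hρJ : ∀ ω, ρ ω ≤ J := fun ω => Nat.findGreatest_le J
  have hρc : ∀ ω, discreteSum a n (ρ ω) ω ≤ c := fun ω =>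
    Nat.findGreatest_spec (P := fun l => discreteSum a n l ω ≤ c) (Nat.zero_le J)
      (by rw [discreteSum_zero]; exact hcpos.le)
  have hlt : ∀ l ω, l < ρ ω ↔ l < J ∧ discreteSum a n (l + 1) ω ≤ c := fun l ω => by
    constructor
    · intro hl
      exact ⟨hl.trans_le (hρJ ω), (h.mono n ω hl).trans (hρc ω)⟩
    · rintro ⟨h1, h2⟩
      exact Nat.le_findGreatest (P := fun l => discreteSum a n l ω ≤ c) h1 h2
  have hρm : ∀ l, MeasurableSet[𝓕.rightCont (grid n l)] {ω | l < ρ ω} := fun l => by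
    simp only [hlt, Set.ofPred_and]
    exact (MeasurableSet.const _).inter
      (measurableSet_le (h.measurable_discreteSum n le_rfl) measurable_const)
  have hρm' : ∀ l, MeasurableSet {ω | l < ρ ω} := fun l => 𝓕.rightCont.le _ _ (hρm l)
  set E : Set Ω := {ω | c < discreteSum a n J ω} with hE
  have hAJ : Measurable (discreteSum a n J) :=
    (h.measurable_discreteSum n (Nat.le_succ J)).mono (𝓕.rightCont.le _) le_rfl
  have hEm : MeasurableSet E := measurableSet_lt measurable_const hAJ
  have hoff : ∀ ω, ω ∉ E → ρ ω = J := fun ω hω =>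
    le_antisymm (hρJ ω) (Nat.le_findGreatest (P := fun l => discreteSum a n l ω ≤ c) le_rfl
      (not_lt.1 hω))
  have hIJ : ∫ ω, discreteSum a n J ω ∂μ = ∫ ω, S (grid n J) ω ∂μ - ∫ ω, S 0 ω ∂μ :=
    h.integral_stopped_eq hS (ρ := fun _ => J) (fun _ => le_rfl) fun l => MeasurableSet.const _
  have hIρ := h.integral_stopped_eq hS hρJ hρm
  have hEδ : μ E ≤ ENNReal.ofReal δ := by
    have h1 := mul_meas_ge_le_integral_of_nonneg (μ := μ)
      (ae_of_all _ fun ω => h.discreteSum_nonneg n J ω) (h.integrable_discreteSum n J) c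
    have h2 : μ.real E ≤ μ.real {ω | c ≤ discreteSum a n J ω} :=
      measureReal_mono fun ω (hω : c < _) => hω.le
    have h3 := abs_le.1 (hSK (grid n J))
    have h4 := abs_le.1 (hSK 0)
    have h5 : c * μ.real E ≤ c * δ := by
      have : c * δ = 2 * K + 1 := by rw [hc]; field_simp
      calc c * μ.real E ≤ c * μ.real {ω | c ≤ discreteSum a n J ω} := by gcongr
        _ ≤ c * δ := by rw [this]; linarith
    rw [← ENNReal.ofReal_toReal (measure_ne_top μ E)]
    exact ENNReal.ofReal_le_ofReal (le_of_mul_le_mul_left h5 hcpos)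
  have hSρ : Integrable (fun ω => S (grid n (ρ ω)) ω) μ :=
    integrable_stopped (x := fun l => S (grid n l)) (fun l => hS _) hρJ hρm'
  have hAρ : Integrable (fun ω => discreteSum a n (ρ ω) ω) μ :=
    integrable_stopped (x := discreteSum a n) (h.integrable_discreteSum n) hρJ hρm'
  -- Optional sampling exchanges the sums for `S`. Off `E` the index `ρ` equals `J`, so only the
  -- small event `E` contributes, and there class D applies.
  have hmain : ∫ ω, (discreteSum a n J ω - discreteSum a n (ρ ω) ω) ∂μ
      = ∫ ω in E, (S (grid n J) ω - S (grid n (ρ ω)) ω) ∂μ := by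
    rw [integral_sub (h.integrable_discreteSum n J) hAρ, hIJ, hIρ, sub_sub_sub_cancel_right,
      ← integral_sub (hS _) hSρ, setIntegral_eq_integral_of_forall_compl_eq_zero]
    intro ω hω
    rw [hoff ω hω, sub_self]
  calc ∫⁻ ω, ENNReal.ofReal (discreteSum a n J ω - c) ∂μ
      ≤ ∫⁻ ω, ENNReal.ofReal (discreteSum a n J ω - discreteSum a n (ρ ω) ω) ∂μ :=
        lintegral_mono fun ω => ENNReal.ofReal_le_ofReal (by linarith [hρc ω])
    _ = ENNReal.ofReal (∫ ω, (discreteSum a n J ω - discreteSum a n (ρ ω) ω) ∂μ) :=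
        (ofReal_integral_eq_lintegral_ofReal ((h.integrable_discreteSum n J).sub hAρ)
          (ae_of_all _ fun ω => sub_nonneg.2 (h.mono n ω (hρJ ω)))).symm
    _ ≤ ∫⁻ ω in E, ‖S (grid n J) ω - S (grid n (ρ ω)) ω‖ₑ ∂μ := by
        rw [hmain]
        refine (ENNReal.ofReal_le_ofReal (le_abs_self _)).trans ?_
        rw [← Real.enorm_eq_ofReal_abs]
        exact enorm_integral_le_lintegral_enorm _
    _ ≤ ∫⁻ ω in E, (‖S (grid n J) ω‖ₑ + ‖S (grid n (ρ ω)) ω‖ₑ) ∂μ :=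
        lintegral_mono fun ω => enorm_sub_le
    _ = ∫⁻ ω in E, ‖S (grid n J) ω‖ₑ ∂μ + ∫⁻ ω in E, ‖S (grid n (ρ ω)) ω‖ₑ ∂μ :=
        lintegral_add_left' (hS _).aestronglyMeasurable.enorm.restrict _
    _ ≤ ENNReal.ofReal (ε / 2) + ENNReal.ofReal (ε / 2) := by
        gcongr
        · exact hunif (fun _ => grid n J) (isStoppingTime_const _ _) E hEm hEδ
        · exact hunif (fun ω => grid n (ρ ω)) (isStoppingTime_grid hρm) E hEm hEδ
    _ = ENNReal.ofReal ε := by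
        rw [← ENNReal.ofReal_add (by positivity) (by positivity), add_halves]

end Compensator


/-! ### Regularized upper limits of step processes -/

section Paths

variable {Ω : Type*}

/-- The left-continuous step process of partial sums along the dyadic grid of mesh `2⁻ⁿ`. -/
noncomputable def stepSum (a : ℕ → ℕ → Ω → ℝ) (n : ℕ) (t : ℝ≥0) (ω : Ω) : ℝ :=
  discreteSum a n ⌈t * 2 ^ n⌉₊ ω

/-- Iterated midpoints of the step processes. -/
noncomputable def midSum (a : ℕ → ℕ → Ω → ℝ) (w : ℕ → MidTree) (k : ℕ) (t : ℝ≥0) (ω : Ω) : ℝ :=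
  (w k).eval (fun n => stepSum a n t ω)

/-- The upper limit of the iterated midpoints. -/
noncomputable def upperSum (a : ℕ → ℕ → Ω → ℝ) (w : ℕ → MidTree) (t : ℝ≥0) (ω : Ω) : ℝ≥0∞ :=
  limsup (fun k => ENNReal.ofReal (midSum a w k t ω)) atTop

/-- The right-continuous regularization of the upper limit. -/
noncomputable def regSum (a : ℕ → ℕ → Ω → ℝ) (w : ℕ → MidTree) (t : ℝ≥0) (ω : Ω) : ℝ≥0∞ :=
  ⨅ q : ℕ × ℕ, if t < grid q.1 q.2 then upperSum a w (grid q.1 q.2) ω else ∞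

variable {a : ℕ → ℕ → Ω → ℝ} {w : ℕ → MidTree}

theorem stepSum_grid (a : ℕ → ℕ → Ω → ℝ) (n l : ℕ) (ω : Ω) :
    stepSum a n (grid n l) ω = discreteSum a n l ω := by
  rw [stepSum, ceil_grid_mul]

theorem stepSum_mono (ha : ∀ n l ω, 0 ≤ a n l ω) (n : ℕ) (ω : Ω) :
    Monotone (fun t => stepSum a n t ω) := fun _ _ hst => by
  refine Finset.sum_le_sum_of_subset_of_nonneg (Finset.range_mono (Nat.ceil_mono ?_))
    fun l _ _ => ha n l ω
  gcongr

theorem stepSum_nonneg (ha : ∀ n l ω, 0 ≤ a n l ω) (n : ℕ) (t : ℝ≥0) (ω : Ω) :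
    0 ≤ stepSum a n t ω := by
  unfold stepSum discreteSum
  exact Finset.sum_nonneg fun l _ => ha n l ω

theorem midSum_mono (ha : ∀ n l ω, 0 ≤ a n l ω) (w : ℕ → MidTree) (k : ℕ) (ω : Ω) :
    Monotone (fun t => midSum a w k t ω) := fun _ _ hst =>
  MidTree.eval_mono (fun n => stepSum_mono ha n ω hst) (w k)

theorem midSum_nonneg (ha : ∀ n l ω, 0 ≤ a n l ω) (w : ℕ → MidTree) (k : ℕ) (t : ℝ≥0) (ω : Ω) :
    0 ≤ midSum a w k t ω := MidTree.eval_nonneg (fun n => stepSum_nonneg ha n t ω) (w k)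

theorem midSum_zero (a : ℕ → ℕ → Ω → ℝ) (w : ℕ → MidTree) (k : ℕ) (ω : Ω) :
    midSum a w k 0 ω = 0 := by
  simp [midSum, stepSum, discreteSum, MidTree.eval_zero]

theorem upperSum_mono (ha : ∀ n l ω, 0 ≤ a n l ω) (w : ℕ → MidTree) (ω : Ω) :
    Monotone (fun t => upperSum a w t ω) := fun _ _ hst =>
  limsup_le_limsup (Eventually.of_forall fun k =>
    ENNReal.ofReal_le_ofReal (midSum_mono ha w k ω hst))

theorem upperSum_zero (a : ℕ → ℕ → Ω → ℝ) (w : ℕ → MidTree) (ω : Ω) : upperSum a w 0 ω = 0 := by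
  simp [upperSum, midSum_zero]

theorem regSum_le_upperSum (ha : ∀ n l ω, 0 ≤ a n l ω) {s t : ℝ≥0} (hst : s < t) (ω : Ω) :
    regSum a w s ω ≤ upperSum a w t ω := by
  obtain ⟨n, l, h1, h2⟩ := exists_grid_between hst
  refine (iInf_le _ (n, l)).trans ?_
  rw [if_pos h1]
  exact upperSum_mono ha w ω h2.le

theorem upperSum_le_regSum (ha : ∀ n l ω, 0 ≤ a n l ω) (t : ℝ≥0) (ω : Ω) :
    upperSum a w t ω ≤ regSum a w t ω := by
  refine le_iInf fun q => ?_
  split_ifs with h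
  · exact upperSum_mono ha w ω h.le
  · exact le_top

theorem regSum_mono (a : ℕ → ℕ → Ω → ℝ) (w : ℕ → MidTree) (ω : Ω) :
    Monotone (fun t => regSum a w t ω) := fun s t hst => by
  refine le_iInf fun q => ?_
  split_ifs with h
  · refine (iInf_le _ q).trans ?_
    rw [if_pos (hst.trans_lt h)]
  · exact le_top

theorem exists_upperSum_lt {t : ℝ≥0} {ω : Ω} {b : ℝ≥0∞} (h : regSum a w t ω < b) :
    ∃ u, t < u ∧ upperSum a w u ω < b := by
  obtain ⟨q, hq⟩ := iInf_lt_iff.1 h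
  split_ifs at hq with h1
  · exact ⟨_, h1, hq⟩
  · exact absurd hq not_top_lt

theorem exists_regSum_lt (ha : ∀ n l ω, 0 ≤ a n l ω) {t : ℝ≥0} {ω : Ω} {b : ℝ≥0∞}
    (h : regSum a w t ω < b) : ∃ u, t < u ∧ regSum a w u ω < b := by
  obtain ⟨u, hu, hub⟩ := exists_upperSum_lt h
  obtain ⟨v, hv, hvu⟩ := exists_between hu
  exact ⟨v, hv, (regSum_le_upperSum ha hvu ω).trans_lt hub⟩

theorem tendsto_upperSum (ha : ∀ n l ω, 0 ≤ a n l ω) {t : ℝ≥0} {u : ℕ → ℝ≥0} (htu : ∀ n, t < u n)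
    (hu : Tendsto u atTop (𝓝 t)) (ω : Ω) :
    Tendsto (fun n => upperSum a w (u n) ω) atTop (𝓝 (regSum a w t ω)) := by
  refine tendsto_order.2 ⟨fun b hb => Eventually.of_forall fun n =>
    hb.trans_le (regSum_le_upperSum ha (htu n) ω), fun b hb => ?_⟩
  obtain ⟨v, hv, hvb⟩ := exists_upperSum_lt hb
  filter_upwards [hu.eventually (eventually_lt_nhds hv)] with n hn
  exact (upperSum_mono ha w ω hn.le).trans_lt hvb

theorem continuousWithinAt_regSum (ha : ∀ n l ω, 0 ≤ a n l ω) (ω : Ω) (t : ℝ≥0) :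
    ContinuousWithinAt (fun s => regSum a w s ω) (Set.Ici t) t := by
  refine tendsto_order.2 ⟨fun b hb => ?_, fun b hb => ?_⟩
  · filter_upwards [self_mem_nhdsWithin] with s hs
    exact hb.trans_le (regSum_mono a w ω hs)
  · obtain ⟨v, hv, hvb⟩ := exists_regSum_lt ha hb
    filter_upwards [mem_nhdsWithin_of_mem_nhds (Iio_mem_nhds hv)] with s hs
    exact (regSum_mono a w ω (le_of_lt hs)).trans_lt hvb

/-- Since the infinite values of an increasing process form a terminal interval, the real part of
the regularization is right-continuous. -/
theorem rightContinuousPaths_regSum (ha : ∀ n l ω, 0 ≤ a n l ω) :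
    RightContinuousPaths (fun t ω => (regSum a w t ω).toReal) := by
  intro ω t
  by_cases h : regSum a w t ω = ∞
  · refine (continuousWithinAt_const (b := (0 : ℝ))).congr_of_eventuallyEq ?_ (by simp [h])
    filter_upwards [self_mem_nhdsWithin] with s hs
    have : regSum a w s ω = ∞ := top_le_iff.1 (h ▸ regSum_mono a w ω hs)
    simp [this]
  · exact (ENNReal.tendsto_toReal h).comp (continuousWithinAt_regSum ha ω t)

end Paths

/-! ### Joint measurability in the parameter, the sample point and time. -/

section Measurability

variable {Ω : Type*}

theorem measurable_stepSum_prod {𝔓 : Type*} [MeasurableSpace 𝔓] [MeasurableSpace Ω]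
    {a : 𝔓 → ℕ → ℕ → Ω → ℝ} (ha : ∀ n l, Measurable (fun q : 𝔓 × Ω => a q.1 n l q.2)) (n : ℕ) :
    Measurable (fun x : 𝔓 × Ω × ℝ≥0 => stepSum (a x.1) n x.2.2 x.2.1) := by
  have h : Measurable (fun r : ℕ × (𝔓 × Ω) => discreteSum (a r.2.1) n r.1 r.2.2) :=
    measurable_from_prod_countable_right fun j => by
      simp only [discreteSum]
      exact Finset.measurable_fun_sum _ fun l _ => ha n l
  have hc : Measurable (fun x : 𝔓 × Ω × ℝ≥0 => ⌈x.2.2 * 2 ^ n⌉₊) :=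
    Nat.measurable_ceil.comp (measurable_snd.snd.mul_const _)
  exact h.comp (hc.prodMk (measurable_fst.prodMk measurable_snd.fst))

variable {𝔓 : Type*} [MeasurableSpace 𝔓] [MeasurableSpace Ω]
  {a : 𝔓 → ℕ → ℕ → Ω → ℝ} {w : ℕ → 𝔓 → MidTree}

theorem measurable_midSum_prod (ha : ∀ n l, Measurable (fun q : 𝔓 × Ω => a q.1 n l q.2))
    (hw : ∀ k, Measurable (w k)) (k : ℕ) :
    Measurable (fun x : 𝔓 × Ω × ℝ≥0 => midSum (a x.1) (fun k => w k x.1) k x.2.2 x.2.1) :=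
  measurable_comp_countable
    (g := fun (v : MidTree) p (y : Ω × ℝ≥0) => v.eval (fun n => stepSum (a p) n y.2 y.1))
    (fun v => MidTree.measurable_eval (fun n => measurable_stepSum_prod ha n) v) (hw k)

theorem measurable_upperSum_prod (ha : ∀ n l, Measurable (fun q : 𝔓 × Ω => a q.1 n l q.2))
    (hw : ∀ k, Measurable (w k)) :
    Measurable (fun x : 𝔓 × Ω × ℝ≥0 => upperSum (a x.1) (fun k => w k x.1) x.2.2 x.2.1) :=
  Measurable.limsup fun k => (measurable_midSum_prod ha hw k).ennreal_ofReal

theorem measurable_regSum_prod (ha : ∀ n l, Measurable (fun q : 𝔓 × Ω => a q.1 n l q.2))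
    (hw : ∀ k, Measurable (w k)) :
    Measurable (fun x : 𝔓 × Ω × ℝ≥0 => regSum (a x.1) (fun k => w k x.1) x.2.2 x.2.1) := by
  unfold regSum
  refine Measurable.iInf fun q => ?_
  have h1 : Measurable (fun x : 𝔓 × Ω × ℝ≥0 =>
      upperSum (a x.1) (fun k => w k x.1) (grid q.1 q.2) x.2.1) :=
    (measurable_upperSum_prod ha hw).comp (g := fun x : 𝔓 × Ω × ℝ≥0 =>
      upperSum (a x.1) (fun k => w k x.1) x.2.2 x.2.1)
      (f := fun x : 𝔓 × Ω × ℝ≥0 => (x.1, x.2.1, grid q.1 q.2))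
      (measurable_fst.prodMk (measurable_snd.fst.prodMk measurable_const))
  have h2 : MeasurableSet {x : 𝔓 × Ω × ℝ≥0 | x.2.2 < grid q.1 q.2} :=
    measurableSet_lt measurable_snd.snd measurable_const
  exact Measurable.ite h2 h1 measurable_const

end Measurability

/-! ### Adaptedness to the right-continuous filtration. -/

section Adapted

variable {Ω : Type*} {m : MeasurableSpace Ω} {𝓕 : Filtration ℝ≥0 m} {a : ℕ → ℕ → Ω → ℝ}
  {w : ℕ → MidTree}

theorem measurable_stepSum (ha : ∀ n l, Measurable[𝓕.rightCont (grid n l)] (a n l)) (n : ℕ)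
    (t : ℝ≥0) : Measurable[𝓕.rightCont t] (stepSum a n t) :=
  Finset.measurable_fun_sum _ fun l hl => (ha n l).mono
    (𝓕.rightCont.mono (lt_ceil_mul_iff.1 (Finset.mem_range.1 hl)).le) le_rfl

theorem measurable_midSum (ha : ∀ n l, Measurable[𝓕.rightCont (grid n l)] (a n l)) (k : ℕ)
    (t : ℝ≥0) : Measurable[𝓕.rightCont t] (midSum a w k t) :=
  @MidTree.measurable_eval Ω (𝓕.rightCont t) _ (fun n => measurable_stepSum ha n t) (w k)

theorem measurable_upperSum (ha : ∀ n l, Measurable[𝓕.rightCont (grid n l)] (a n l))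
    (t : ℝ≥0) : Measurable[𝓕.rightCont t] (upperSum a w t) :=
  @Measurable.limsup _ _ _ _ _ (𝓕.rightCont t) _ _ _ _
    fun k => (measurable_midSum ha k t).ennreal_ofReal

theorem rightCont_le_of_lt (𝓕 : Filtration ℝ≥0 m) {s t : ℝ≥0} (h : s < t) :
    𝓕.rightCont s ≤ 𝓕 t := by
  rw [𝓕.rightCont_eq]
  exact iInf₂_le t h

theorem measurable_rightCont_of_forall_lt {E : Type*} [MeasurableSpace E] {f : Ω → E} {t : ℝ≥0}
    (h : ∀ u, t < u → Measurable[𝓕 u] f) : Measurable[𝓕.rightCont t] f := by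
  rw [measurable_iff_comap_le, 𝓕.rightCont_eq]
  exact le_iInf₂ fun u hu => measurable_iff_comap_le.1 (h u hu)

/-- By monotonicity the infimum may be restricted to grid points in `(t, u)`, for any `u > t`; it is
then measurable for `𝓕 u`. No completion is involved. -/
theorem measurable_regSum (hn : ∀ n l ω, 0 ≤ a n l ω)
    (ha : ∀ n l, Measurable[𝓕.rightCont (grid n l)] (a n l)) (t : ℝ≥0) :
    Measurable[𝓕.rightCont t] (regSum a w t) := by
  refine measurable_rightCont_of_forall_lt fun u hu => ?_
  have e : regSum a w t = fun ω => ⨅ q : ℕ × ℕ, if t < grid q.1 q.2 ∧ grid q.1 q.2 < u then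
      upperSum a w (grid q.1 q.2) ω else ∞ := by
    funext ω
    refine le_antisymm (le_iInf fun q => ?_) (le_iInf fun q => ?_)
    · split_ifs with h
      · exact regSum_le_upperSum hn h.1 ω
      · exact le_top
    · split_ifs with h
      · obtain ⟨n, l, h1, h2⟩ := exists_grid_between (lt_min h hu)
        refine (iInf_le _ (n, l)).trans ?_
        rw [if_pos ⟨h1, h2.trans_le (min_le_right _ _)⟩]
        exact upperSum_mono hn w ω (h2.le.trans (min_le_left _ _))
      · exact le_top
  rw [e]
  refine Measurable.iInf (mδ := 𝓕 u) fun q => ?_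
  by_cases h : t < grid q.1 q.2 ∧ grid q.1 q.2 < u
  · simp only [h, and_self, if_true]
    exact (measurable_upperSum ha _).mono (rightCont_le_of_lt 𝓕 h.2) le_rfl
  · simp only [h, if_false]
    exact measurable_const

end Adapted


/-! ### The compensated process is a martingale -/

section Fast

variable {Ω : Type*} {m : MeasurableSpace Ω} {μ : Measure Ω}

/-- Iterated midpoints of discrete compensators that converge fast in `L¹` at all integer times. -/
structure IsFastCompensator (𝓕 : Filtration ℝ≥0 m) (μ : Measure Ω) (S : ℝ≥0 → Ω → ℝ)
    (a : ℕ → ℕ → Ω → ℝ) (w : ℕ → MidTree) : Prop extends IsCompensator 𝓕 μ S a where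
  leaves : ∀ k, (w k).LeavesGE k
  fast : ∀ N : ℕ, ∑' k, ∫⁻ ω, ‖midSum a w (k + 1) N ω - midSum a w k N ω‖ₑ ∂μ ≠ ∞
  integrable_process : ∀ t, Integrable (S t) μ

theorem lintegral_enorm_le_of_setIntegral_eq [IsProbabilityMeasure μ] {𝒢 : MeasurableSpace Ω}
    (h𝒢 : 𝒢 ≤ m) {f g : Ω → ℝ} (hf : Integrable f μ) (hg : Integrable g μ) (hfm : Measurable[𝒢] f)
    (h : ∀ B, MeasurableSet[𝒢] B → ∫ ω in B, f ω ∂μ = ∫ ω in B, g ω ∂μ) :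
    ∫⁻ ω, ‖f ω‖ₑ ∂μ ≤ ∫⁻ ω, ‖g ω‖ₑ ∂μ := by
  have h1 : f =ᵐ[μ] μ[g | 𝒢] := ae_eq_condExp_of_forall_setIntegral_eq h𝒢 hg
    (fun _ _ _ => hf.integrableOn) (fun B hB _ => h B hB) hfm.stronglyMeasurable.aestronglyMeasurable
  have h2 := eLpNorm_condExp_le_eLpNorm (m := 𝒢) (μ := μ) g le_rfl
  rw [← eLpNorm_congr_ae h1, eLpNorm_one_eq_lintegral_enorm, eLpNorm_one_eq_lintegral_enorm] at h2
  exact h2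

variable {𝓕 : Filtration ℝ≥0 m} {S : ℝ≥0 → Ω → ℝ} {a : ℕ → ℕ → Ω → ℝ} {w : ℕ → MidTree}

theorem IsCompensator.integrable_stepSum (h : IsCompensator 𝓕 μ S a) (n : ℕ) (t : ℝ≥0) :
    Integrable (stepSum a n t) μ := h.integrable_discreteSum n _

theorem IsCompensator.setIntegral_discreteSum (h : IsCompensator 𝓕 μ S a)
    (hS : ∀ t, Integrable (S t) μ) {n i j : ℕ} (hij : i ≤ j) {B : Set Ω}
    (hB : MeasurableSet[𝓕.rightCont (grid n i)] B) :
    ∫ ω in B, (discreteSum a n j ω - discreteSum a n i ω) ∂μ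
      = ∫ ω in B, (S (grid n j) ω - S (grid n i) ω) ∂μ := by
  induction j, hij using Nat.le_induction with
  | base => simp
  | succ j hij ih =>
    have e1 : ∀ ω, discreteSum a n (j + 1) ω - discreteSum a n i ω
        = (discreteSum a n j ω - discreteSum a n i ω) + a n j ω := fun ω => by
      rw [← discreteSum_succ_sub a n j ω]; ring
    have e2 : ∀ ω, S (grid n (j + 1)) ω - S (grid n i) ω
        = (S (grid n j) ω - S (grid n i) ω) + (S (grid n (j + 1)) ω - S (grid n j) ω) :=
      fun ω => by ring
    have i1 : Integrable (fun ω => discreteSum a n j ω - discreteSum a n i ω) μ :=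
      (h.integrable_discreteSum n j).sub (h.integrable_discreteSum n i)
    have i2 : ∀ s t, Integrable (fun ω => S s ω - S t ω) μ := fun s t => (hS s).sub (hS t)
    simp_rw [e1, e2]
    rw [integral_add i1.integrableOn (h.integrable n j).integrableOn,
      integral_add (i2 _ _).integrableOn (i2 _ _).integrableOn, ih,
      h.setIntegral n j B (𝓕.rightCont.mono (grid_mono n hij) _ hB)]

/-- A dyadic grid is contained in every finer one, so each step process with `n ≥ n₀` compensates
`S` along the grid of mesh `2⁻ⁿ⁰`. -/
theorem IsCompensator.setIntegral_stepSum (h : IsCompensator 𝓕 μ S a)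
    (hS : ∀ t, Integrable (S t) μ) {n₀ n i j : ℕ} (hn : n₀ ≤ n) (hij : i ≤ j) {B : Set Ω}
    (hB : MeasurableSet[𝓕.rightCont (grid n₀ i)] B) :
    ∫ ω in B, (stepSum a n (grid n₀ j) ω - stepSum a n (grid n₀ i) ω) ∂μ
      = ∫ ω in B, (S (grid n₀ j) ω - S (grid n₀ i) ω) ∂μ := by
  rw [exists_grid_eq hn] at hB
  rw [exists_grid_eq hn i, exists_grid_eq hn j]
  simp only [stepSum_grid]
  exact h.setIntegral_discreteSum hS (Nat.mul_le_mul_right _ hij) hB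

namespace IsFastCompensator

theorem integrable_midSum (h : IsFastCompensator 𝓕 μ S a w) (k : ℕ) (t : ℝ≥0) :
    Integrable (midSum a w k t) μ :=
  MidTree.eval_induction (Q := fun f => Integrable f μ) (f := fun n ω => stepSum a n t ω) (k := 0)
    (fun _ _ hg hh => (hg.add hh).div_const 2) (fun n _ => h.integrable_stepSum n t)
    (w k).leavesGE_zero

theorem measurable_midSum (h : IsFastCompensator 𝓕 μ S a w) (k : ℕ) (t : ℝ≥0) :
    Measurable (midSum a w k t) :=
  (DoobMeyer.measurable_midSum h.measurable k t).mono (𝓕.rightCont.le t) le_rfl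

theorem measurable_upperSum (h : IsFastCompensator 𝓕 μ S a w) (t : ℝ≥0) :
    Measurable (upperSum a w t) :=
  (DoobMeyer.measurable_upperSum h.measurable t).mono (𝓕.rightCont.le t) le_rfl

theorem measurable_regSum (h : IsFastCompensator 𝓕 μ S a w) (t : ℝ≥0) :
    Measurable (regSum a w t) :=
  (DoobMeyer.measurable_regSum h.nonneg h.measurable t).mono (𝓕.rightCont.le t) le_rfl

/-- The identity is affine in the step process, so it survives midpoints; labels at least `k ≥ n₀`
ensure that every leaf satisfies it. -/
theorem setIntegral_midSum (h : IsFastCompensator 𝓕 μ S a w) {n₀ k i j : ℕ} (hk : n₀ ≤ k)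
    (hij : i ≤ j) {B : Set Ω} (hB : MeasurableSet[𝓕.rightCont (grid n₀ i)] B) :
    ∫ ω in B, (midSum a w k (grid n₀ j) ω - midSum a w k (grid n₀ i) ω) ∂μ
      = ∫ ω in B, (S (grid n₀ j) ω - S (grid n₀ i) ω) ∂μ := by
  -- Time is part of the argument, so that the induction hypothesis speaks of both times at once.
  refine (MidTree.eval_induction (X := ℝ≥0 × Ω) (f := fun n x => stepSum a n x.1 x.2) (k := n₀)
    (Q := fun f => (∀ t, Integrable (fun ω => f (t, ω)) μ) ∧
      ∫ ω in B, (f (grid n₀ j, ω) - f (grid n₀ i, ω)) ∂μ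
        = ∫ ω in B, (S (grid n₀ j) ω - S (grid n₀ i) ω) ∂μ) ?_
    (fun n hn => ⟨h.integrable_stepSum n, h.setIntegral_stepSum h.integrable_process hn hij hB⟩)
    ((h.leaves k).mono hk)).2
  rintro f g ⟨hf, hf'⟩ ⟨hg, hg'⟩
  refine ⟨fun t => ((hf t).add (hg t)).div_const 2, ?_⟩
  have e : ∀ ω, (f (grid n₀ j, ω) + g (grid n₀ j, ω)) / 2 - (f (grid n₀ i, ω) + g (grid n₀ i, ω)) / 2
      = ((f (grid n₀ j, ω) - f (grid n₀ i, ω)) + (g (grid n₀ j, ω) - g (grid n₀ i, ω))) / 2 :=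
    fun ω => by ring
  have i1 : Integrable (fun ω => f (grid n₀ j, ω) - f (grid n₀ i, ω)) μ := (hf _).sub (hf _)
  have i2 : Integrable (fun ω => g (grid n₀ j, ω) - g (grid n₀ i, ω)) μ := (hg _).sub (hg _)
  simp only [e]
  rw [integral_div, integral_add i1.integrableOn i2.integrableOn, hf', hg']
  ring

/-- Two midpoint processes both compensate `S` along the coarse grid, so their difference is a
martingale there, and its `L¹` norm is at most the one at the later time `N`. -/
theorem lintegral_enorm_midSum_sub_le [IsProbabilityMeasure μ] (h : IsFastCompensator 𝓕 μ S a w)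
    {n₀ k i N : ℕ} (hk : n₀ ≤ k) (hi : i ≤ N * 2 ^ n₀) :
    ∫⁻ ω, ‖midSum a w (k + 1) (grid n₀ i) ω - midSum a w k (grid n₀ i) ω‖ₑ ∂μ
      ≤ ∫⁻ ω, ‖midSum a w (k + 1) N ω - midSum a w k N ω‖ₑ ∂μ := by
  refine lintegral_enorm_le_of_setIntegral_eq (𝓕.rightCont.le (grid n₀ i))
    ((h.integrable_midSum _ _).sub (h.integrable_midSum _ _))
    ((h.integrable_midSum _ _).sub (h.integrable_midSum _ _))
    ((DoobMeyer.measurable_midSum h.measurable _ _).sub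
      (DoobMeyer.measurable_midSum h.measurable _ _)) fun B hB => ?_
  have hN : (N : ℝ≥0) = grid n₀ (N * 2 ^ n₀) := by rw [← grid_zero_left, exists_grid_eq n₀.zero_le]; rfl
  have h1 := h.setIntegral_midSum (hk.trans (Nat.le_succ k)) hi hB
  have h2 := h.setIntegral_midSum hk hi hB
  rw [← hN] at h1 h2
  rw [integral_sub (h.integrable_midSum _ _).integrableOn (h.integrable_midSum _ _).integrableOn]
    at h1 h2 ⊢
  rw [integral_sub (h.integrable_midSum _ _).integrableOn (h.integrable_midSum _ _).integrableOn]
  linarith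

theorem tsum_grid_ne_top [IsProbabilityMeasure μ] (h : IsFastCompensator 𝓕 μ S a w) (n₀ i : ℕ) :
    ∑' k, ∫⁻ ω, ‖midSum a w (k + 1 + n₀) (grid n₀ i) ω - midSum a w (k + n₀) (grid n₀ i) ω‖ₑ ∂μ
      ≠ ∞ := by
  -- The integer `i` serves as a crude bound for the time `grid n₀ i`.
  have hi : i ≤ i * 2 ^ n₀ := Nat.le_mul_of_pos_right _ (by positivity)
  refine ne_top_of_le_ne_top (h.fast i) (le_trans (ENNReal.tsum_le_tsum fun k => ?_)
    (ENNReal.tsum_comp_le_tsum_of_injective (add_left_injective n₀) _))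
  rw [add_right_comm]
  exact h.lintegral_enorm_midSum_sub_le (Nat.le_add_left n₀ k) hi

end IsFastCompensator

/-- An integrable majorant of the step processes up to time `N`. -/
noncomputable def majorant (a : ℕ → ℕ → Ω → ℝ) (w : ℕ → MidTree) (N : ℕ) (ω : Ω) : ℝ≥0∞ :=
  ‖midSum a w 0 N ω‖ₑ + ∑' k, ‖midSum a w (k + 1) N ω - midSum a w k N ω‖ₑ

theorem ofReal_midSum_le_majorant (ha : ∀ n l ω, 0 ≤ a n l ω) (k : ℕ) {N : ℕ} {t : ℝ≥0}
    (ht : t ≤ N) (ω : Ω) : ENNReal.ofReal (midSum a w k t ω) ≤ majorant a w N ω := by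
  refine le_trans ?_ (enorm_le_add_tsum (h := fun k => midSum a w k N ω) k)
  rw [Real.enorm_eq_ofReal_abs]
  exact ENNReal.ofReal_le_ofReal ((midSum_mono ha w k ω ht).trans (le_abs_self _))

theorem upperSum_le_majorant (ha : ∀ n l ω, 0 ≤ a n l ω) {N : ℕ} {t : ℝ≥0}
    (ht : t ≤ N) (ω : Ω) : upperSum a w t ω ≤ majorant a w N ω :=
  limsup_le_of_le (by isBoundedDefault)
    (Eventually.of_forall fun k => ofReal_midSum_le_majorant ha k ht ω)

theorem regSum_le_majorant (ha : ∀ n l ω, 0 ≤ a n l ω) {N : ℕ} {t : ℝ≥0}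
    (ht : t < N) (ω : Ω) : regSum a w t ω ≤ majorant a w N ω :=
  (regSum_le_upperSum ha ht ω).trans (upperSum_le_majorant ha le_rfl ω)

namespace IsFastCompensator

theorem measurable_majorant (h : IsFastCompensator 𝓕 μ S a w) (N : ℕ) :
    Measurable (majorant a w N) :=
  (h.measurable_midSum 0 N).enorm.add
    (Measurable.tsum (measurable_enorm_sub fun k => h.measurable_midSum k N))

theorem lintegral_majorant_ne_top (h : IsFastCompensator 𝓕 μ S a w) (N : ℕ) :
    ∫⁻ ω, majorant a w N ω ∂μ ≠ ∞ :=
  lintegral_add_tsum_ne_top (fun k => h.measurable_midSum k N)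
    (h.integrable_midSum 0 N).hasFiniteIntegral.ne (h.fast N)

theorem integrable_majorant (h : IsFastCompensator 𝓕 μ S a w) (N : ℕ) :
    Integrable (fun ω => (majorant a w N ω).toReal) μ :=
  integrable_toReal_of_lintegral_ne_top (h.measurable_majorant N).aemeasurable
    (h.lintegral_majorant_ne_top N)

theorem ae_majorant_lt_top (h : IsFastCompensator 𝓕 μ S a w) :
    ∀ᵐ ω ∂μ, ∀ N, majorant a w N ω < ∞ :=
  ae_all_iff.2 fun N => ae_lt_top (h.measurable_majorant N) (h.lintegral_majorant_ne_top N)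

theorem ae_regSum_ne_top (h : IsFastCompensator 𝓕 μ S a w) :
    ∀ᵐ ω ∂μ, ∀ t, regSum a w t ω ≠ ∞ := by
  filter_upwards [h.ae_majorant_lt_top] with ω hω t
  obtain ⟨N, hN⟩ := exists_nat_gt t
  exact ((regSum_le_majorant h.nonneg hN ω).trans_lt (hω N)).ne

theorem ae_upperSum_ne_top (h : IsFastCompensator 𝓕 μ S a w) :
    ∀ᵐ ω ∂μ, ∀ t, upperSum a w t ω ≠ ∞ := by
  filter_upwards [h.ae_regSum_ne_top] with ω hω t
  exact ne_top_of_le_ne_top (hω t) (upperSum_le_regSum h.nonneg t ω)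

theorem integrable_upperSum (h : IsFastCompensator 𝓕 μ S a w) (t : ℝ≥0) :
    Integrable (fun ω => (upperSum a w t ω).toReal) μ := by
  obtain ⟨N, hN⟩ := exists_nat_gt t
  refine integrable_toReal_of_lintegral_ne_top (h.measurable_upperSum t).aemeasurable
    (ne_top_of_le_ne_top (h.lintegral_majorant_ne_top N) (lintegral_mono fun ω => ?_))
  exact upperSum_le_majorant h.nonneg hN.le ω

theorem lintegral_regSum_ne_top (h : IsFastCompensator 𝓕 μ S a w) (t : ℝ≥0) :
    ∫⁻ ω, regSum a w t ω ∂μ ≠ ∞ := by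
  obtain ⟨N, hN⟩ := exists_nat_gt t
  exact ne_top_of_le_ne_top (h.lintegral_majorant_ne_top N)
    (lintegral_mono fun ω => regSum_le_majorant h.nonneg hN ω)

theorem integrable_regSum (h : IsFastCompensator 𝓕 μ S a w) (t : ℝ≥0) :
    Integrable (fun ω => (regSum a w t ω).toReal) μ :=
  integrable_toReal_of_lintegral_ne_top (h.measurable_regSum t).aemeasurable
    (h.lintegral_regSum_ne_top t)

theorem ae_tendsto_midSum [IsProbabilityMeasure μ] (h : IsFastCompensator 𝓕 μ S a w) (n₀ i : ℕ) :
    ∀ᵐ ω ∂μ, Tendsto (fun k => midSum a w k (grid n₀ i) ω) atTop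
      (𝓝 (upperSum a w (grid n₀ i) ω).toReal) := by
  filter_upwards [ae_exists_tendsto_of_tsum (h := fun k => midSum a w (k + n₀) (grid n₀ i))
    (fun k => h.measurable_midSum _ _) (h.tsum_grid_ne_top n₀ i)] with ω ⟨y, hy⟩
  have hy' : Tendsto (fun k => midSum a w k (grid n₀ i) ω) atTop (𝓝 y) :=
    (tendsto_add_atTop_iff_nat n₀).1 hy
  have hy0 : 0 ≤ y := ge_of_tendsto' hy' fun k => midSum_nonneg h.nonneg w k _ ω
  have h1 : upperSum a w (grid n₀ i) ω = ENNReal.ofReal y :=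
    (ENNReal.tendsto_ofReal hy').limsup_eq
  rwa [h1, ENNReal.toReal_ofReal hy0]

theorem tendsto_setIntegral_midSum [IsProbabilityMeasure μ] (h : IsFastCompensator 𝓕 μ S a w)
    (n₀ i : ℕ) (B : Set Ω) :
    Tendsto (fun k => ∫ ω in B, midSum a w k (grid n₀ i) ω ∂μ) atTop
      (𝓝 (∫ ω in B, (upperSum a w (grid n₀ i) ω).toReal ∂μ)) := by
  obtain ⟨N, hN⟩ := exists_nat_gt (grid n₀ i)
  refine tendsto_integral_of_dominated_convergence (fun ω => (majorant a w N ω).toReal)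
    (fun k => (h.measurable_midSum _ _).aestronglyMeasurable) (h.integrable_majorant N).integrableOn
    (fun k => ae_restrict_of_ae ?_) (ae_restrict_of_ae (h.ae_tendsto_midSum n₀ i))
  filter_upwards [h.ae_majorant_lt_top] with ω hω
  rw [Real.norm_eq_abs, abs_of_nonneg (midSum_nonneg h.nonneg w k _ ω),
    ← ENNReal.ofReal_le_iff_le_toReal (hω N).ne]
  exact ofReal_midSum_le_majorant h.nonneg k hN.le ω

theorem setIntegral_upperSum [IsProbabilityMeasure μ] (h : IsFastCompensator 𝓕 μ S a w)
    {n₀ i j : ℕ} (hij : i ≤ j) {B : Set Ω} (hB : MeasurableSet[𝓕.rightCont (grid n₀ i)] B) :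
    ∫ ω in B, ((upperSum a w (grid n₀ j) ω).toReal - (upperSum a w (grid n₀ i) ω).toReal) ∂μ
      = ∫ ω in B, (S (grid n₀ j) ω - S (grid n₀ i) ω) ∂μ := by
  rw [integral_sub (h.integrable_upperSum _).integrableOn (h.integrable_upperSum _).integrableOn]
  refine tendsto_nhds_unique ((h.tendsto_setIntegral_midSum n₀ j B).sub
    (h.tendsto_setIntegral_midSum n₀ i B)) (tendsto_const_nhds.congr' ?_)
  filter_upwards [eventually_ge_atTop n₀] with k hk
  rw [← h.setIntegral_midSum hk hij hB,
    integral_sub (h.integrable_midSum _ _).integrableOn (h.integrable_midSum _ _).integrableOn]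

end IsFastCompensator

/-- The point of the grid of mesh `2⁻ⁿ` that follows `t` strictly. -/
noncomputable def nextGrid (n : ℕ) (t : ℝ≥0) : ℝ≥0 := grid n (⌊t * 2 ^ n⌋₊ + 1)

theorem lt_nextGrid (n : ℕ) (t : ℝ≥0) : t < nextGrid n t := by
  rw [nextGrid, ← not_le, grid_le_iff]; omega

theorem nextGrid_le (n : ℕ) (t : ℝ≥0) : nextGrid n t ≤ t + (1 / 2) ^ n := by
  have h1 : grid n ⌊t * 2 ^ n⌋₊ ≤ t := grid_le_iff.2 le_rfl
  have h2 : grid n (⌊t * 2 ^ n⌋₊ + 1) = grid n ⌊t * 2 ^ n⌋₊ + (1 / 2) ^ n := by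
    unfold grid; push_cast; rw [add_div, one_div_pow]
  rw [nextGrid, h2]
  gcongr

theorem tendsto_nextGrid (t : ℝ≥0) : Tendsto (fun n => nextGrid n t) atTop (𝓝 t) := by
  have h : Tendsto (fun n : ℕ => t + (1 / 2 : ℝ≥0) ^ n) atTop (𝓝 (t + 0)) :=
    tendsto_const_nhds.add (NNReal.tendsto_pow_atTop_nhds_zero_of_lt_one
      (by rw [← NNReal.coe_lt_coe]; norm_num))
  rw [add_zero] at h
  exact tendsto_of_tendsto_of_tendsto_of_le_of_le tendsto_const_nhds h
    (fun n => (lt_nextGrid n t).le) fun n => nextGrid_le n t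

/-- Deterministic times are stopping times, so class D gives uniform integrability along `nextGrid n
t`; with right-continuity of the paths, Vitali's theorem yields convergence in `L¹`. -/
theorem IsClassD.tendsto_setIntegral [IsProbabilityMeasure μ]
    (hD : IsClassD S (usualAugmentation 𝓕 μ) μ)
    (hrc : RightContinuousPaths S) (hS : ∀ t, Integrable (S t) μ) (t : ℝ≥0) (B : Set Ω) :
    Tendsto (fun n => ∫ ω in B, S (nextGrid n t) ω ∂μ) atTop (𝓝 (∫ ω in B, S t ω ∂μ)) := by
  have hUI : UnifIntegrable (fun n => S (nextGrid n t)) 1 μ := fun ε hε => by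
    obtain ⟨δ, hδ, h⟩ := hD.2.1 hε
    exact ⟨δ, hδ, fun n => h ⟨fun _ => (nextGrid n t : WithTop ℝ≥0), isStoppingTime_const _ _,
      fun _ => WithTop.coe_ne_top⟩⟩
  have hlim : ∀ᵐ ω ∂μ, Tendsto (fun n => S (nextGrid n t) ω) atTop (𝓝 (S t ω)) :=
    ae_of_all _ fun ω => (hrc ω t).tendsto.comp (tendsto_nhdsWithin_iff.2
      ⟨tendsto_nextGrid t, Eventually.of_forall fun n => (lt_nextGrid n t).le⟩)
  have h1 := tendsto_Lp_finite_of_tendsto_ae le_rfl ENNReal.one_ne_top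
    (fun n => (hS (nextGrid n t)).aestronglyMeasurable) (memLp_one_iff_integrable.2 (hS t)) hUI hlim
  refine tendsto_setIntegral_of_L1' (S t) (hS t).aestronglyMeasurable (Eventually.of_forall fun n => hS _) h1 B

namespace IsFastCompensator

theorem tendsto_setIntegral_upperSum (h : IsFastCompensator 𝓕 μ S a w) (t : ℝ≥0) (B : Set Ω) :
    Tendsto (fun n => ∫ ω in B, (upperSum a w (nextGrid n t) ω).toReal ∂μ) atTop
      (𝓝 (∫ ω in B, (regSum a w t ω).toReal ∂μ)) := by
  -- The points `nextGrid n t` exceed `t` by at most `1`, so the majorant up to `N > t + 1`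
  -- dominates the whole sequence.
  obtain ⟨N, hN⟩ := exists_nat_gt (t + 1)
  refine tendsto_integral_of_dominated_convergence (fun ω => (majorant a w N ω).toReal)
    (fun k => (h.measurable_upperSum _).ennreal_toReal.aestronglyMeasurable)
    (h.integrable_majorant N).integrableOn
    (fun k => ae_restrict_of_ae ?_) (ae_restrict_of_ae ?_)
  · filter_upwards [h.ae_majorant_lt_top] with ω hω
    rw [Real.norm_eq_abs, abs_of_nonneg ENNReal.toReal_nonneg]
    refine ENNReal.toReal_mono (hω N).ne (upperSum_le_majorant h.nonneg ?_ ω)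
    refine (nextGrid_le k t).trans (le_trans ?_ hN.le)
    gcongr
    exact pow_le_one₀ zero_le (by rw [← NNReal.coe_le_coe]; norm_num)
  · filter_upwards [h.ae_regSum_ne_top] with ω hω
    exact (ENNReal.tendsto_toReal (hω t)).comp
      (tendsto_upperSum h.nonneg (fun n => lt_nextGrid n t) (tendsto_nextGrid t) ω)

/-- At dyadic times the regularization does not change the upper limit. -/
theorem ae_regSum_eq_upperSum [IsProbabilityMeasure μ] (h : IsFastCompensator 𝓕 μ S a w)
    (hD : IsClassD S (usualAugmentation 𝓕 μ) μ) (hrc : RightContinuousPaths S) :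
    ∀ᵐ ω ∂μ, ∀ n l, regSum a w (grid n l) ω = upperSum a w (grid n l) ω := by
  refine ae_all_iff.2 fun n₀ => ae_all_iff.2 fun i => ?_
  set t := grid n₀ i with ht
  have h1 := (h.tendsto_setIntegral_upperSum t Set.univ).sub
    (tendsto_const_nhds (x := ∫ ω, (upperSum a w t ω).toReal ∂μ))
  have h2 := (hD.tendsto_setIntegral hrc h.integrable_process t Set.univ).sub
    (tendsto_const_nhds (x := ∫ ω, S t ω ∂μ))
  simp only [Measure.restrict_univ] at h1 h2
  -- From the right, the means of `upperSum` converge to the mean of `regSum`, but their increments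
  -- are those of the means of `S`, which tend to zero. Two ordered variables with equal means agree
  -- almost surely.
  have h3 := tendsto_nhds_unique (h1.congr' ?_) h2
  · rw [sub_self] at h3
    have h4 : (fun ω => (upperSum a w t ω).toReal) =ᵐ[μ] fun ω => (regSum a w t ω).toReal := by
      refine (integral_eq_iff_of_ae_le (h.integrable_upperSum t) (h.integrable_regSum t) ?_).1
        (sub_eq_zero.1 h3).symm
      filter_upwards [h.ae_regSum_ne_top] with ω hω
      exact ENNReal.toReal_mono (hω t) (upperSum_le_regSum h.nonneg t ω)
    filter_upwards [h4, h.ae_regSum_ne_top, h.ae_upperSum_ne_top] with ω e1 e2 e3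
    exact ((ENNReal.toReal_eq_toReal_iff' (e3 t) (e2 t)).1 e1).symm
  · filter_upwards [eventually_ge_atTop n₀] with n hn
    have hi : i * 2 ^ (n - n₀) ≤ ⌊t * 2 ^ n⌋₊ + 1 :=
      (grid_le_iff.1 (by rw [ht, exists_grid_eq hn])).trans (Nat.le_succ _)
    have h4 := h.setIntegral_upperSum (n₀ := n) hi (B := Set.univ) MeasurableSet.univ
    rw [← exists_grid_eq hn, ← ht, Measure.restrict_univ,
      integral_sub (h.integrable_upperSum _) (h.integrable_upperSum _),
      integral_sub (h.integrable_process _) (h.integrable_process _)] at h4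
    exact h4

theorem setIntegral_regSum [IsProbabilityMeasure μ] (h : IsFastCompensator 𝓕 μ S a w)
    (hD : IsClassD S (usualAugmentation 𝓕 μ) μ) (hrc : RightContinuousPaths S) {s t : ℝ≥0}
    (hst : s ≤ t) {B : Set Ω} (hB : MeasurableSet[𝓕.rightCont s] B) :
    ∫ ω in B, (regSum a w t ω).toReal ∂μ - ∫ ω in B, (regSum a w s ω).toReal ∂μ
      = ∫ ω in B, S t ω ∂μ - ∫ ω in B, S s ω ∂μ := by
  refine tendsto_nhds_unique ((h.tendsto_setIntegral_upperSum t B).sub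
    (h.tendsto_setIntegral_upperSum s B))
    (((hD.tendsto_setIntegral hrc h.integrable_process t B).sub
      (hD.tendsto_setIntegral hrc h.integrable_process s B)).congr fun n => ?_)
  have hij : ⌊s * 2 ^ n⌋₊ + 1 ≤ ⌊t * 2 ^ n⌋₊ + 1 := by gcongr
  have h4 := h.setIntegral_upperSum hij (B := B) (𝓕.rightCont.mono (lt_nextGrid n s).le _ hB)
  rw [integral_sub (h.integrable_upperSum _).integrableOn (h.integrable_upperSum _).integrableOn,
    integral_sub (h.integrable_process _).integrableOn (h.integrable_process _).integrableOn] at h4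
  exact h4.symm

end IsFastCompensator

/-- The sets almost surely equal to a set known at `t+` form a sigma-field that contains the null
sets. Integral identities therefore need to be tested only on sets of the unaugmented filtration. -/
theorem exists_ae_eq_of_usualAugmentation {t : ℝ≥0} {B : Set Ω}
    (hB : MeasurableSet[usualAugmentation 𝓕 μ t] B) :
    ∃ B', MeasurableSet[𝓕.rightCont t] B' ∧ B =ᵐ[μ] B' := by
  have hle : usualAugmentation 𝓕 μ t ≤ eventuallyMeasurableSpace (𝓕.rightCont t) (ae μ) := by
    refine sup_le (fun s hs => ⟨s, hs, EventuallyEq.rfl⟩) (MeasurableSpace.generateFrom_le ?_)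
    rintro s ⟨-, hs⟩
    exact ⟨∅, @MeasurableSet.empty _ (𝓕.rightCont t), ae_eq_empty.2 hs⟩
  exact hle B hB

/-- Subtracting the regularized compensator yields a martingale. -/
theorem IsFastCompensator.martingale [IsProbabilityMeasure μ] (h : IsFastCompensator 𝓕 μ S a w)
    (hD : IsClassD S (usualAugmentation 𝓕 μ) μ) (hrc : RightContinuousPaths S)
    (hSa : StronglyAdapted 𝓕.rightCont S) :
    Martingale (fun t ω => S t ω - S 0 ω - (regSum a w t ω).toReal) (usualAugmentation 𝓕 μ) μ := by
  have hi : ∀ t, Integrable (fun ω => S t ω - S 0 ω - (regSum a w t ω).toReal) μ := fun t =>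
    ((h.integrable_process t).sub (h.integrable_process 0)).sub (h.integrable_regSum t)
  have hm : ∀ t, StronglyMeasurable[usualAugmentation 𝓕 μ t]
      (fun ω => S t ω - S 0 ω - (regSum a w t ω).toReal) := fun t => by
    refine StronglyMeasurable.mono ?_ (le_sup_left : 𝓕.rightCont t ≤ usualAugmentation 𝓕 μ t)
    exact ((hSa t).sub ((hSa 0).mono (𝓕.rightCont.mono zero_le))).sub
      (DoobMeyer.measurable_regSum h.nonneg h.measurable t).ennreal_toReal.stronglyMeasurable
  refine ⟨hm, fun s t hst => ?_⟩
  refine (ae_eq_condExp_of_forall_setIntegral_eq ((usualAugmentation 𝓕 μ).le s) (hi t)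
    (fun _ _ _ => (hi s).integrableOn) (fun B hB _ => ?_) (hm s).aestronglyMeasurable).symm
  obtain ⟨B', hB', he⟩ := exists_ae_eq_of_usualAugmentation hB
  rw [setIntegral_congr_set he, setIntegral_congr_set he]
  have e : ∀ u, ∫ ω in B', (S u ω - S 0 ω - (regSum a w u ω).toReal) ∂μ
      = ∫ ω in B', S u ω ∂μ - ∫ ω in B', S 0 ω ∂μ - ∫ ω in B', (regSum a w u ω).toReal ∂μ := by
    intro u
    have i1 : Integrable (fun ω => S u ω - S 0 ω) μ :=
      (h.integrable_process u).sub (h.integrable_process 0)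
    rw [integral_sub i1.integrableOn (h.integrable_regSum u).integrableOn,
      integral_sub (h.integrable_process u).integrableOn (h.integrable_process 0).integrableOn]
  rw [e, e]
  have := h.setIntegral_regSum hD hrc hst hB'
  linarith

end Fast


/-! ### Evanescence of the regularization error -/

section Hitting

variable {Ω : Type*} {m : MeasurableSpace Ω} {μ : Measure Ω}
  {𝓕 : Filtration ℝ≥0 m} {S : ℝ≥0 → Ω → ℝ} {a : ℕ → ℕ → Ω → ℝ} {w : ℕ → MidTree}

/-- The first time before `N` at which the regularized sum reaches the level `b`. -/
noncomputable def hitTime (a : ℕ → ℕ → Ω → ℝ) (w : ℕ → MidTree) (b : ℝ≥0∞) (N : ℕ) (ω : Ω) : ℝ≥0 :=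
  sInf ({t | b ≤ regSum a w t ω} ∪ {(N : ℝ≥0)})

theorem hitTime_le (b : ℝ≥0∞) (N : ℕ) (ω : Ω) : hitTime a w b N ω ≤ N :=
  csInf_le (OrderBot.bddBelow _) (Or.inr rfl)

theorem hitTime_le_of_le {b : ℝ≥0∞} {N : ℕ} {ω : Ω} {t : ℝ≥0} (h : b ≤ regSum a w t ω) :
    hitTime a w b N ω ≤ t :=
  csInf_le (OrderBot.bddBelow _) (Or.inl h)

/-- By right-continuity, a value below `b` at `t` stays below `b` for a while. The event that the
level is hit after `t` is thus read off from the value at `t` alone, and the measurability of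
hitting times needs no début theorem. -/
theorem lt_hitTime_iff (ha : ∀ n l ω, 0 ≤ a n l ω) {b : ℝ≥0∞} {N : ℕ} {ω : Ω} {t : ℝ≥0} :
    t < hitTime a w b N ω ↔ t < N ∧ regSum a w t ω < b := by
  constructor
  · intro h
    refine ⟨h.trans_le (hitTime_le b N ω), not_le.1 fun h' => ?_⟩
    exact h.not_ge (hitTime_le_of_le h')
  · rintro ⟨h1, h2⟩
    obtain ⟨u, hu, hub⟩ := exists_regSum_lt ha h2
    refine (lt_min hu h1).trans_le (le_csInf ⟨_, Or.inr rfl⟩ ?_)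
    rintro s (hs | rfl)
    · refine (min_le_left _ _).trans (not_lt.1 fun hsu => ?_)
      exact ((regSum_mono a w ω hsu.le).trans_lt hub).not_ge hs
    · exact min_le_right _ _

theorem measurable_comp_of_prod {E : Type*} [MeasurableSpace E] {f : ℝ≥0 → Ω → E}
    (hf : Measurable (fun x : Unit × Ω × ℝ≥0 => f x.2.2 x.2.1)) {τ : Ω → ℝ≥0} (hτ : Measurable τ) :
    Measurable (fun ω => f (τ ω) ω) :=
  hf.comp (measurable_const.prodMk (measurable_id.prodMk hτ) :
    Measurable (fun ω => ((), ω, τ ω)))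

namespace IsFastCompensator

theorem measurable_coeff (h : IsFastCompensator 𝓕 μ S a w) (n l : ℕ) : Measurable (a n l) :=
  (h.measurable n l).mono (𝓕.rightCont.le _) le_rfl

theorem measurable_coeff_prod (h : IsFastCompensator 𝓕 μ S a w) (n l : ℕ) :
    Measurable (fun q : Unit × Ω => a n l q.2) := (h.measurable_coeff n l).comp measurable_snd

/-- On grid-valued times `regSum` and `upperSum` agree almost surely. `upperSum` and `discreteSum`
both start at zero and have increments with the same integrals over events of the past, so stopping
them gives equal means. -/
theorem lintegral_regSum_grid_le [IsProbabilityMeasure μ] (h : IsFastCompensator 𝓕 μ S a w)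
    (hD : IsClassD S (usualAugmentation 𝓕 μ) μ) (hrc : RightContinuousPaths S) {n J : ℕ}
    {ρ : Ω → ℕ} (hJ : ∀ ω, ρ ω ≤ J)
    (hρ : ∀ l, MeasurableSet[𝓕.rightCont (grid n l)] {ω | l < ρ ω}) :
    ∫⁻ ω, regSum a w (grid n (ρ ω)) ω ∂μ = ∫⁻ ω, ENNReal.ofReal (discreteSum a n (ρ ω) ω) ∂μ := by
  have hρ' : ∀ l, MeasurableSet {ω | l < ρ ω} := fun l => 𝓕.rightCont.le _ _ (hρ l)
  set x : ℕ → Ω → ℝ := fun l ω => (upperSum a w (grid n l) ω).toReal with hx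
  have hxi : ∀ l, Integrable (x l) μ := fun l => h.integrable_upperSum _
  have hxρ : Integrable (fun ω => x (ρ ω) ω) μ := integrable_stopped hxi hJ hρ'
  have h1 : ∫⁻ ω, regSum a w (grid n (ρ ω)) ω ∂μ = ∫⁻ ω, ENNReal.ofReal (x (ρ ω) ω) ∂μ := by
    refine lintegral_congr_ae ?_
    filter_upwards [h.ae_regSum_eq_upperSum hD hrc, h.ae_upperSum_ne_top] with ω e1 e2
    rw [e1, ENNReal.ofReal_toReal (e2 _)]
  have h2 : ∫ ω, x (ρ ω) ω ∂μ = ∫ ω, discreteSum a n (ρ ω) ω ∂μ := by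
    rw [integral_stopped hxi hJ hρ',
      integral_stopped (x := discreteSum a n) (h.integrable_discreteSum n) hJ hρ']
    congr 1
    · simp [hx, upperSum_zero, discreteSum_zero]
    · refine Finset.sum_congr rfl fun l _ => ?_
      simp only [discreteSum_succ_sub]
      rw [h.setIntegral n l _ (hρ l)]
      exact h.setIntegral_upperSum (Nat.le_succ l) (hρ l)
  rw [h1, ← ofReal_integral_eq_lintegral_ofReal hxρ (ae_of_all _ fun _ => ENNReal.toReal_nonneg), h2,
    ofReal_integral_eq_lintegral_ofReal
      (integrable_stopped (x := discreteSum a n) (h.integrable_discreteSum n) hJ hρ')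
      (ae_of_all _ fun ω => h.discreteSum_nonneg n _ ω)]

/-- Rounding `τ` up to the grid leaves the step process unchanged and can only increase `regSum`; on
the rounded time the means are equal. The resulting bound is stable under midpoints. -/
theorem lintegral_regSum_stopped_le [IsProbabilityMeasure μ] (h : IsFastCompensator 𝓕 μ S a w)
    (hD : IsClassD S (usualAugmentation 𝓕 μ) μ) (hrc : RightContinuousPaths S) {N : ℕ}
    {τ : Ω → ℝ≥0} (hN : ∀ ω, τ ω ≤ N) (hτm : Measurable τ)
    (hτ : ∀ t, MeasurableSet[𝓕.rightCont t] {ω | t < τ ω}) (k : ℕ) :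
    ∫⁻ ω, regSum a w (τ ω) ω ∂μ ≤ ∫⁻ ω, ENNReal.ofReal (midSum a w k (τ ω) ω) ∂μ := by
  refine (MidTree.eval_induction (f := fun n ω => stepSum a n (τ ω) ω) (k := 0)
    (Q := fun f => Measurable f ∧ (∀ ω, 0 ≤ f ω) ∧
      ∫⁻ ω, regSum a w (τ ω) ω ∂μ ≤ ∫⁻ ω, ENNReal.ofReal (f ω) ∂μ) ?_ ?_ (w k).leavesGE_zero).2.2
  · rintro f g ⟨hf, hf0, hf'⟩ ⟨hg, hg0, hg'⟩
    refine ⟨(hf.add hg).div_const 2, fun ω => by linarith [hf0 ω, hg0 ω], ?_⟩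
    have e2 : (2⁻¹ : ℝ≥0∞) = ENNReal.ofReal 2⁻¹ := by
      rw [ENNReal.ofReal_inv_of_pos two_pos]; simp
    have e : ∀ ω, ENNReal.ofReal ((f ω + g ω) / 2)
        = 2⁻¹ * (ENNReal.ofReal (f ω) + ENNReal.ofReal (g ω)) := fun ω => by
      rw [e2, ← ENNReal.ofReal_add (hf0 ω) (hg0 ω), ← ENNReal.ofReal_mul (by norm_num)]
      congr 1; ring
    simp_rw [e]
    rw [lintegral_const_mul _ (by fun_prop), lintegral_add_left (by fun_prop)]
    calc ∫⁻ ω, regSum a w (τ ω) ω ∂μ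
        = 2⁻¹ * (∫⁻ ω, regSum a w (τ ω) ω ∂μ + ∫⁻ ω, regSum a w (τ ω) ω ∂μ) := by
          rw [← two_mul, ← mul_assoc, ENNReal.inv_mul_cancel (by norm_num) (by norm_num), one_mul]
      _ ≤ _ := by gcongr
  · intro n _
    refine ⟨measurable_comp_of_prod
      (measurable_stepSum_prod (a := fun _ : Unit => a) h.measurable_coeff_prod n) hτm,
      fun ω => stepSum_nonneg h.nonneg n _ ω, ?_⟩
    have hρ : ∀ l, MeasurableSet[𝓕.rightCont (grid n l)] {ω | l < ⌈τ ω * 2 ^ n⌉₊} := fun l => by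
      simp only [lt_ceil_mul_iff]; exact hτ _
    have hJ : ∀ ω, ⌈τ ω * 2 ^ n⌉₊ ≤ N * 2 ^ n := fun ω => by
      rw [Nat.ceil_le]; push_cast; gcongr; exact hN ω
    exact (lintegral_mono fun ω => regSum_mono a w ω (le_grid_ceil n (τ ω))).trans
      (h.lintegral_regSum_grid_le hD hrc hJ hρ).le

/-- The reverse Fatou lemma, with the integrable majorant up to `N`, passes the bound for each
midpoint process to the upper limit. With `upperSum ≤ regSum` the means agree, hence so do the
variables almost surely. -/
theorem ae_upperSum_stopped_eq [IsProbabilityMeasure μ] (h : IsFastCompensator 𝓕 μ S a w)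
    (hD : IsClassD S (usualAugmentation 𝓕 μ) μ) (hrc : RightContinuousPaths S) {N : ℕ}
    {τ : Ω → ℝ≥0} (hN : ∀ ω, τ ω ≤ N) (hτ : ∀ t, MeasurableSet[𝓕.rightCont t] {ω | t < τ ω}) :
    ∀ᵐ ω ∂μ, upperSum a w (τ ω) ω = regSum a w (τ ω) ω := by
  have hτm : Measurable τ := measurable_of_Ioi fun t => 𝓕.rightCont.le t _ (hτ t)
  have hmid : ∀ k, Measurable (fun ω => ENNReal.ofReal (midSum a w k (τ ω) ω)) := fun k =>
    (measurable_comp_of_prod (measurable_midSum_prod (a := fun _ : Unit => a)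
      (w := fun k _ => w k) h.measurable_coeff_prod (fun _ => measurable_const) k)
      hτm).ennreal_ofReal
  have hreg : Measurable (fun ω => regSum a w (τ ω) ω) :=
    measurable_comp_of_prod (measurable_regSum_prod (a := fun _ : Unit => a)
      (w := fun k _ => w k) h.measurable_coeff_prod (fun _ => measurable_const)) hτm
  have h1 : ∫⁻ ω, regSum a w (τ ω) ω ∂μ ≤ ∫⁻ ω, upperSum a w (τ ω) ω ∂μ :=
    calc ∫⁻ ω, regSum a w (τ ω) ω ∂μ
        ≤ limsup (fun k => ∫⁻ ω, ENNReal.ofReal (midSum a w k (τ ω) ω) ∂μ) atTop :=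
          le_limsup_of_le (by isBoundedDefault) fun b hb => by
            obtain ⟨k, hk⟩ := hb.exists
            exact (h.lintegral_regSum_stopped_le hD hrc hN hτm hτ k).trans hk
      _ ≤ _ := limsup_lintegral_le (majorant a w N) hmid
          (fun k => ae_of_all _ fun ω => ofReal_midSum_le_majorant h.nonneg k (hN ω) ω)
          (h.lintegral_majorant_ne_top N)
  refine ae_eq_of_ae_le_of_lintegral_le (ae_of_all _ fun ω => upperSum_le_regSum h.nonneg _ ω)
    ?_ hreg.aemeasurable h1
  exact ne_top_of_le_ne_top (h.lintegral_majorant_ne_top N)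
    (lintegral_mono fun ω => upperSum_le_majorant h.nonneg (hN ω) ω)

/-- The regularization differs from the upper limit only on an evanescent set. -/
theorem ae_upperSum_eq_regSum [IsProbabilityMeasure μ] (h : IsFastCompensator 𝓕 μ S a w)
    (hD : IsClassD S (usualAugmentation 𝓕 μ) μ) (hrc : RightContinuousPaths S) :
    ∀ᵐ ω ∂μ, ∀ t, upperSum a w t ω = regSum a w t ω := by
  have hhit : ∀ᵐ ω ∂μ, ∀ (q : ℚ) (N : ℕ),
      upperSum a w (hitTime a w (Real.toNNReal q) N ω) ω
        = regSum a w (hitTime a w (Real.toNNReal q) N ω) ω := by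
    refine ae_all_iff.2 fun q => ae_all_iff.2 fun N =>
      h.ae_upperSum_stopped_eq hD hrc (fun ω => hitTime_le _ N ω) fun t => ?_
    simp only [lt_hitTime_iff h.nonneg, Set.ofPred_and]
    exact (MeasurableSet.const _).inter (measurableSet_lt
      (DoobMeyer.measurable_regSum h.nonneg h.measurable t) measurable_const)
  filter_upwards [hhit, h.ae_regSum_eq_upperSum hD hrc] with ω h1 h2 t
  refine le_antisymm (upperSum_le_regSum h.nonneg t ω) (not_lt.1 fun hlt => ?_)
  obtain ⟨q, -, hq1, hq2⟩ := ENNReal.lt_iff_exists_rat_btwn.1 hlt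
  -- With `N > t`, a hitting time that is less than `t` is not an effect of the truncation at `N`.
  obtain ⟨N, hN⟩ := exists_nat_gt t
  have hle : hitTime a w (Real.toNNReal q) N ω ≤ t := hitTime_le_of_le hq2.le
  rcases hle.lt_or_eq with hlt' | heq
  · have h3 : ((Real.toNNReal q : ℝ≥0) : ℝ≥0∞)
        ≤ regSum a w (hitTime a w (Real.toNNReal q) N ω) ω := by
      by_contra hcon
      exact lt_irrefl _ ((lt_hitTime_iff h.nonneg).2 ⟨hlt'.trans hN, not_le.1 hcon⟩)
    -- A hit strictly before `t` is impossible: at any earlier time `regSum` is at most `upperSum`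
    -- at `t`, which lies below the level.
    obtain ⟨n, l, hl1, hl2⟩ := exists_grid_between hlt'
    have h4 : regSum a w (hitTime a w (Real.toNNReal q) N ω) ω ≤ upperSum a w t ω :=
      (regSum_le_upperSum h.nonneg hl1 ω).trans (upperSum_mono h.nonneg w ω hl2.le)
    exact (hq1.trans_le (h3.trans h4)).false
  · have h5 := h1 q N
    rw [heq] at h5
    exact hlt.ne h5

end IsFastCompensator

end Hitting

/-! ### Predictability -/

section Predictable

variable {Ω : Type*} {m : MeasurableSpace Ω} {μ : Measure Ω} {𝓕 : Filtration ℝ≥0 m}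

theorem measurableSet_predictable_Ioi {t : ℝ≥0} {B : Set Ω}
    (hB : MeasurableSet[usualAugmentation 𝓕 μ t] B) :
    MeasurableSet[predictableSigma (nullSigma μ) (usualAugmentation 𝓕 μ)] (Set.Ioi t ×ˢ B) :=
  MeasurableSpace.measurableSet_generateFrom (Or.inr ⟨t, B, hB, rfl⟩)

theorem measurableSet_predictable_null {N : Set Ω} (hN : MeasurableSet N) (hμ : μ N = 0) :
    MeasurableSet[predictableSigma (nullSigma μ) (usualAugmentation 𝓕 μ)]
      ((Set.univ : Set ℝ≥0) ×ˢ N) := by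
  have hN' : MeasurableSet[nullSigma μ] N := MeasurableSpace.measurableSet_generateFrom ⟨hN, hμ⟩
  have e : (Set.univ : Set ℝ≥0) ×ˢ N = ({0} : Set ℝ≥0) ×ˢ N ∪ Set.Ioi 0 ×ˢ N := by
    ext ⟨t, ω⟩
    simp only [Set.mem_prod, Set.mem_univ, true_and, Set.mem_union, Set.mem_singleton_iff,
      Set.mem_Ioi]
    rcases eq_or_ne t 0 with h | h
    · simp [h]
    · simp [h, pos_iff_ne_zero]
  rw [e]
  exact MeasurableSet.union
    (MeasurableSpace.measurableSet_generateFrom (Or.inl ⟨N, hN', rfl⟩))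
    (measurableSet_predictable_Ioi ((le_sup_right : nullSigma μ ≤ usualAugmentation 𝓕 μ 0) _ hN'))

/-- On a null set every measurable set is predictable. -/
theorem measurableSet_predictable_inter_null {N : Set Ω} (hN : MeasurableSet N) (hμ : μ N = 0)
    {C : Set (ℝ≥0 × Ω)} (hC : MeasurableSet C) :
    MeasurableSet[predictableSigma (nullSigma μ) (usualAugmentation 𝓕 μ)]
      (C ∩ (Set.univ : Set ℝ≥0) ×ˢ N) := by
  let 𝒱 := predictableSigma (nullSigma μ) (usualAugmentation 𝓕 μ)
  let E : Set (ℝ≥0 × Ω) := (Set.univ : Set ℝ≥0) ×ˢ N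
  have hE : MeasurableSet[𝒱] E := measurableSet_predictable_null hN hμ
  have hnull : ∀ B, MeasurableSet B → MeasurableSet[nullSigma μ] (B ∩ N) := fun B hB =>
    MeasurableSpace.measurableSet_generateFrom
      ⟨hB.inter hN, measure_mono_null Set.inter_subset_right hμ⟩
  -- In the trace of the predictable sigma-field on `E`, both coordinates are measurable, because
  -- every measurable subset of `N` is a null set and so belongs to the sigma-field at time `0-`.
  -- Hence the trace contains that of the product sigma-field.
  let 𝒬 : MeasurableSpace E := MeasurableSpace.comap Subtype.val 𝒱
  have h1 : Measurable[𝒬] (fun x : E => x.1.1) := by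
    refine @measurable_of_Ioi _ _ _ _ _ 𝒬 _ _ _ _ fun t => ⟨Set.Ioi t ×ˢ N, ?_, ?_⟩
    · exact measurableSet_predictable_Ioi ((le_sup_right : nullSigma μ ≤ usualAugmentation 𝓕 μ t) _
        (MeasurableSpace.measurableSet_generateFrom ⟨hN, hμ⟩))
    · ext ⟨⟨s, ω⟩, hx⟩
      have hω : ω ∈ N := hx.2
      simp [hω]
  have h2 : Measurable[𝒬] (fun x : E => x.1.2) := by
    intro B hB
    refine ⟨(Set.univ : Set ℝ≥0) ×ˢ (B ∩ N), measurableSet_predictable_null (hB.inter hN)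
      (measure_mono_null Set.inter_subset_right hμ), ?_⟩
    ext ⟨⟨s, ω⟩, hx⟩
    have hω : ω ∈ N := hx.2
    simp [hω]
  obtain ⟨D, hD, hDC⟩ := (h1.prodMk h2) hC
  have e : C ∩ E = D ∩ E := by
    ext x
    refine and_congr_left fun hx => ?_
    exact (Set.ext_iff.1 hDC ⟨x, hx⟩).symm
  change MeasurableSet[𝒱] (C ∩ E)
  rw [e]
  exact @MeasurableSet.inter _ 𝒱 _ _ hD hE

/-- A measurable process that is indistinguishable from a predictable process is predictable. -/
theorem isAugPredictable_of_ae_eq {X Y : ℝ≥0 → Ω → ℝ}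
    (hX : Measurable (fun x : ℝ≥0 × Ω => X x.1 x.2)) (hY : IsAugPredictable 𝓕 μ Y)
    (h : ∀ᵐ ω ∂μ, ∀ t, X t ω = Y t ω) : IsAugPredictable 𝓕 μ X := by
  obtain ⟨N, hsub, hN, hμ⟩ := exists_measurable_superset_of_null (ae_iff.1 h)
  intro U hU
  let 𝒱 := predictableSigma (nullSigma μ) (usualAugmentation 𝓕 μ)
  have e : (fun x : ℝ≥0 × Ω => X x.1 x.2) ⁻¹' U
      = ((fun x : ℝ≥0 × Ω => Y x.1 x.2) ⁻¹' U \ (Set.univ : Set ℝ≥0) ×ˢ N)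
        ∪ ((fun x : ℝ≥0 × Ω => X x.1 x.2) ⁻¹' U ∩ (Set.univ : Set ℝ≥0) ×ˢ N) := by
    ext ⟨t, ω⟩
    by_cases hω : ω ∈ N
    · simp [hω]
    · have h1 : ∀ t, X t ω = Y t ω := by
        by_contra hcon
        exact hω (hsub hcon)
      simp [hω, h1]
  rw [e]
  exact @MeasurableSet.union _ 𝒱 _ _
    (@MeasurableSet.diff _ 𝒱 _ _ (hY hU) (measurableSet_predictable_null hN hμ))
    (measurableSet_predictable_inter_null hN hμ (hX hU))

theorem measurable_predictable_indicator {t : ℝ≥0} {f : Ω → ℝ}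
    (hf : Measurable[𝓕.rightCont t] f) :
    Measurable[predictableSigma (nullSigma μ) (usualAugmentation 𝓕 μ)]
      (fun x : ℝ≥0 × Ω => if t < x.1 then f x.2 else 0) := by
  let 𝒱 := predictableSigma (nullSigma μ) (usualAugmentation 𝓕 μ)
  intro U hU
  have h1 : MeasurableSet[𝒱] (Set.Ioi t ×ˢ (f ⁻¹' U)) := measurableSet_predictable_Ioi
    ((le_sup_left : 𝓕.rightCont t ≤ usualAugmentation 𝓕 μ t) _ (hf hU))
  have h2 : MeasurableSet[𝒱] (Set.Ioi t ×ˢ (Set.univ : Set Ω)) :=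
    measurableSet_predictable_Ioi MeasurableSet.univ
  by_cases h0 : (0 : ℝ) ∈ U
  · have e : (fun x : ℝ≥0 × Ω => if t < x.1 then f x.2 else 0) ⁻¹' U
        = Set.Ioi t ×ˢ (f ⁻¹' U) ∪ (Set.Ioi t ×ˢ (Set.univ : Set Ω))ᶜ := by
      ext ⟨s, ω⟩
      by_cases hs : t < s
      · simp [hs]
      · simp [hs, h0]
    rw [e]
    exact @MeasurableSet.union _ 𝒱 _ _ h1 (@MeasurableSet.compl _ _ 𝒱 h2)
  · have e : (fun x : ℝ≥0 × Ω => if t < x.1 then f x.2 else 0) ⁻¹' U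
        = Set.Ioi t ×ˢ (f ⁻¹' U) := by
      ext ⟨s, ω⟩
      by_cases hs : t < s
      · simp [hs]
      · simp [hs, h0]
    rw [e]
    exact h1

/-- The step process is the locally finite sum of the elementary processes `a n l` on `(grid n l,
∞)`. It vanishes at time `0`, so the small sigma-field at `0-` is no obstacle. -/
theorem measurable_predictable_stepSum {a : ℕ → ℕ → Ω → ℝ}
    (ha : ∀ n l, Measurable[𝓕.rightCont (grid n l)] (a n l)) (n : ℕ) :
    Measurable[predictableSigma (nullSigma μ) (usualAugmentation 𝓕 μ)]
      (fun x : ℝ≥0 × Ω => stepSum a n x.1 x.2) := by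
  let 𝒱 := predictableSigma (nullSigma μ) (usualAugmentation 𝓕 μ)
  refine @measurable_of_tendsto_metrizable _ _ 𝒱 _ _ _ _
    (fun (J : ℕ) (x : ℝ≥0 × Ω) => ∑ l ∈ Finset.range J, if grid n l < x.1 then a n l x.2 else 0) _
    (fun J => @Finset.measurable_fun_sum _ _ _ _ _ _ 𝒱 _ _ fun l _ =>
      measurable_predictable_indicator (ha n l)) (tendsto_pi_nhds.2 fun x => ?_)
  refine tendsto_const_nhds.congr' ?_
  filter_upwards [eventually_ge_atTop ⌈x.1 * 2 ^ n⌉₊] with J hJ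
  rw [← Finset.sum_filter, stepSum, discreteSum]
  congr 1
  ext l
  simp only [Finset.mem_filter, Finset.mem_range, ← lt_ceil_mul_iff]
  exact ⟨fun h => ⟨h.trans_le hJ, h⟩, fun h => h.2⟩

theorem isAugPredictable_upperSum {a : ℕ → ℕ → Ω → ℝ}
    (ha : ∀ n l, Measurable[𝓕.rightCont (grid n l)] (a n l)) (w : ℕ → MidTree) :
    IsAugPredictable 𝓕 μ (fun t ω => (upperSum a w t ω).toReal) := by
  let 𝒱 := predictableSigma (nullSigma μ) (usualAugmentation 𝓕 μ)
  refine Measurable.ennreal_toReal (Measurable.limsup (mδ := 𝒱) fun k =>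
    Measurable.ennreal_ofReal ?_)
  exact @MidTree.measurable_eval _ 𝒱 _ (fun n => measurable_predictable_stepSum ha n) (w k)

/-- The regularized compensator is predictable. -/
theorem IsFastCompensator.isAugPredictable [IsProbabilityMeasure μ] {S : ℝ≥0 → Ω → ℝ}
    {a : ℕ → ℕ → Ω → ℝ} {w : ℕ → MidTree} (h : IsFastCompensator 𝓕 μ S a w)
    (hD : IsClassD S (usualAugmentation 𝓕 μ) μ) (hrc : RightContinuousPaths S) :
    IsAugPredictable 𝓕 μ (fun t ω => (regSum a w t ω).toReal) := by
  refine isAugPredictable_of_ae_eq ?_ (isAugPredictable_upperSum h.measurable w) ?_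
  · have h1 := measurable_regSum_prod (a := fun _ : Unit => a) (w := fun k _ => w k)
      h.measurable_coeff_prod (fun _ => measurable_const)
    exact (h1.comp (measurable_const.prodMk (measurable_snd.prodMk measurable_fst) :
      Measurable (fun x : ℝ≥0 × Ω => ((), x.2, x.1)))).ennreal_toReal
  · filter_upwards [h.ae_upperSum_eq_regSum hD hrc] with ω hω t
    rw [hω t]

theorem IsFastCompensator.ae_monotone {S : ℝ≥0 → Ω → ℝ}
    {a : ℕ → ℕ → Ω → ℝ} {w : ℕ → MidTree} (h : IsFastCompensator 𝓕 μ S a w) :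
    ∀ᵐ ω ∂μ, Monotone (fun t => (regSum a w t ω).toReal) := by
  filter_upwards [h.ae_regSum_ne_top] with ω hω s t hst
  exact ENNReal.toReal_mono (hω t) (regSum_mono a w ω hst)

end Predictable


/-! ### The Doob–Meyer decomposition -/

section Decomposition

theorem iInf_seq_add_half_pow {Ω : Type*} {m : MeasurableSpace Ω} (𝓕 : Filtration ℝ≥0 m) (t : ℝ≥0) :
    ⨅ j : ℕ, 𝓕 (t + (1 / 2) ^ j) = 𝓕.rightCont t := by
  refine le_antisymm ?_ (le_iInf fun j => rightCont_le_of_lt 𝓕 (lt_add_of_pos_right t (by positivity)))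
  rw [𝓕.rightCont_eq]
  refine le_iInf₂ fun u hu => ?_
  obtain ⟨j, hj⟩ := exists_pow_lt_of_lt_one (tsub_pos_of_lt hu)
    (by rw [← NNReal.coe_lt_coe]; norm_num : (1 / 2 : ℝ≥0) < 1)
  refine (iInf_le _ j).trans (𝓕.mono ?_)
  calc t + (1 / 2) ^ j ≤ t + (u - t) := by gcongr
    _ = u := add_tsub_cancel_of_le (le_of_lt hu)

variable {𝔓 Ω : Type*} [MeasurableSpace 𝔓] [mΩ : MeasurableSpace Ω]

/-- Discrete compensators that are measurable in the probability measure. -/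
theorem exists_measurable_isCompensator (κ : Kernel 𝔓 Ω) [IsMarkovKernel κ]
    (𝓕 : Filtration ℝ≥0 mΩ) (h𝓕 : ∀ t, @MeasurableSpace.CountablyGenerated Ω (𝓕 t))
    {S : 𝔓 → ℝ≥0 → Ω → ℝ} (hSm : Measurable (fun x : 𝔓 × Ω × ℝ≥0 => S x.1 x.2.2 x.2.1))
    (hsub : ∀ p, Submartingale (S p) (usualAugmentation 𝓕 (κ p)) (κ p)) :
    ∃ a : 𝔓 → ℕ → ℕ → Ω → ℝ, (∀ n l, Measurable (fun q : 𝔓 × Ω => a q.1 n l q.2)) ∧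
      ∀ p, IsCompensator 𝓕 (κ p) (S p) (a p) := by
  have hSt : ∀ t, Measurable (fun q : 𝔓 × Ω => S q.1 t q.2) := fun t =>
    hSm.comp (measurable_fst.prodMk (measurable_snd.prodMk measurable_const) :
      Measurable (fun q : 𝔓 × Ω => (q.1, q.2, t)))
  have hanti : ∀ t, Antitone (fun j : ℕ => (𝓕 (t + (1 / 2) ^ j) : MeasurableSpace Ω)) :=
    fun t i j hij => 𝓕.mono (by
      gcongr t + ?_
      exact pow_le_pow_of_le_one zero_le (by rw [← NNReal.coe_le_coe]; norm_num) hij)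
  choose Y hY hYm hYi hYe using fun n l => exists_measurable_condExp_iInf κ
    (X := fun p ω => S p (grid n (l + 1)) ω - S p (grid n l) ω) ((hSt _).sub (hSt _))
    (fun p => ((hsub p).integrable _).sub ((hsub p).integrable _))
    (𝒢 := fun j => 𝓕 (grid n l + (1 / 2) ^ j)) (fun j => 𝓕.le _) (hanti _) (fun j => h𝓕 _)
  replace hYm : ∀ n l p, Measurable[𝓕.rightCont (grid n l)] (Y n l p) := fun n l p => by
    rw [← iInf_seq_add_half_pow]; exact hYm n l p
  replace hYe : ∀ n l p B, MeasurableSet[𝓕.rightCont (grid n l)] B → ∫ ω in B, Y n l p ω ∂κ p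
      = ∫ ω in B, (S p (grid n (l + 1)) ω - S p (grid n l) ω) ∂κ p := fun n l p B hB => by
    rw [← iInf_seq_add_half_pow] at hB; exact hYe n l p B hB
  have hY0 : ∀ n l p, ∀ᵐ ω ∂κ p, 0 ≤ Y n l p ω := by
    intro n l p
    -- The set where the density is negative belongs to the past; the submartingale property makes
    -- the integral over it nonnegative, so it is null.
    set B : Set Ω := {ω | Y n l p ω < 0} with hB
    have hBm : MeasurableSet[𝓕.rightCont (grid n l)] B :=
      measurableSet_lt (hYm n l p) measurable_const
    have h1 : 0 ≤ ∫ ω in B, Y n l p ω ∂κ p := by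
      rw [hYe n l p B hBm,
        integral_sub ((hsub p).integrable _).integrableOn ((hsub p).integrable _).integrableOn,
        sub_nonneg]
      exact (hsub p).setIntegral_le (grid_mono n (Nat.le_succ l))
        ((le_sup_left : _ ≤ usualAugmentation 𝓕 (κ p) (grid n l)) _ hBm)
    have hBm' := 𝓕.rightCont.le _ _ hBm
    have h2 : ∫ ω, B.indicator (fun ω => -Y n l p ω) ω ∂κ p ≤ 0 := by
      rw [integral_indicator hBm', integral_neg]; linarith
    have h3 : 0 ≤ B.indicator (fun ω => -Y n l p ω) := fun ω =>
      Set.indicator_nonneg (f := fun ω => -Y n l p ω)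
        (fun ω (hω : Y n l p ω < 0) => neg_nonneg.2 hω.le) ω
    have h4 := (integral_eq_zero_iff_of_nonneg h3 ((hYi n l p).neg.indicator hBm')).1
      (le_antisymm h2 (integral_nonneg h3))
    filter_upwards [h4] with ω hω
    by_contra hcon
    rw [Set.indicator_of_mem (show ω ∈ B from not_le.1 hcon)] at hω
    have : -Y n l p ω = 0 := hω
    exact hcon (by linarith)
  have hmax : ∀ n l p, (fun ω => max (Y n l p ω) 0) =ᵐ[κ p] Y n l p := fun n l p => by
    filter_upwards [hY0 n l p] with ω hω
    exact max_eq_left hω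
  -- Truncation at zero gives nonnegativity for every `ω`, so that all partial sums are monotone
  -- pathwise and not merely almost surely.
  refine ⟨fun p n l ω => max (Y n l p ω) 0, fun n l => (hY n l).max measurable_const, fun p =>
    ⟨fun n l ω => le_max_right _ _, fun n l => (hYm n l p).max measurable_const,
      fun n l => (hYi n l p).congr (hmax n l p).symm, fun n l B hB => ?_⟩⟩
  rw [← hYe n l p B hB]
  exact integral_congr_ae (ae_restrict_of_ae (hmax n l p))

theorem exists_measure_nat_pos :
    ∃ ν : Measure ℕ, IsProbabilityMeasure ν ∧ ∀ N : ℕ, ν {N} ≠ 0 := by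
  refine ⟨(Measure.count : Measure ℕ).toFinite, inferInstance, fun N h => ?_⟩
  have := absolutelyContinuous_toFinite (Measure.count : Measure ℕ) h
  simp at this

theorem measurable_stepSum_seq {a : 𝔓 → ℕ → ℕ → Ω → ℝ}
    (ha : ∀ n l, Measurable (fun q : 𝔓 × Ω => a q.1 n l q.2)) (c : ℕ → ℝ≥0) (n : ℕ) :
    Measurable (fun q : 𝔓 × Ω × ℕ => stepSum (a q.1) n (c q.2.2) q.2.1) := by
  have h2 : Measurable (fun q : 𝔓 × Ω × ℕ => ((q.1, q.2.1, c q.2.2) : 𝔓 × Ω × ℝ≥0)) :=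
    measurable_fst.prodMk (measurable_snd.fst.prodMk
      ((measurable_of_countable c).comp measurable_snd.snd))
  have h3 := (measurable_stepSum_prod ha n).comp h2
  exact h3

theorem lintegral_mul_singleton_le {μ : Measure Ω} [SFinite μ] {ν : Measure ℕ} [SFinite ν]
    {f : Ω × ℕ → ℝ≥0∞} (hf : Measurable f) (N : ℕ) :
    (∫⁻ ω, f (ω, N) ∂μ) * ν {N} ≤ ∫⁻ x, f x ∂μ.prod ν := by
  rw [lintegral_prod_symm' _ hf, lintegral_countable' (μ := ν)]
  exact ENNReal.le_tsum (f := fun N : ℕ => (∫⁻ ω, f (ω, N) ∂μ) * ν {N}) N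

/-- Fast converging midpoints of discrete compensators, measurably in the probability measure. -/
theorem exists_measurable_isFastCompensator (κ : Kernel 𝔓 Ω) [IsMarkovKernel κ]
    (𝓕 : Filtration ℝ≥0 mΩ) (h𝓕 : ∀ t, @MeasurableSpace.CountablyGenerated Ω (𝓕 t))
    {S : 𝔓 → ℝ≥0 → Ω → ℝ} (hSm : Measurable (fun x : 𝔓 × Ω × ℝ≥0 => S x.1 x.2.2 x.2.1))
    (hsub : ∀ p, Submartingale (S p) (usualAugmentation 𝓕 (κ p)) (κ p))
    (hD : ∀ p, IsClassD (S p) (usualAugmentation 𝓕 (κ p)) (κ p)) :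
    ∃ (a : 𝔓 → ℕ → ℕ → Ω → ℝ) (w : ℕ → 𝔓 → MidTree),
      (∀ n l, Measurable (fun q : 𝔓 × Ω => a q.1 n l q.2)) ∧ (∀ k, Measurable (w k)) ∧
      ∀ p, IsFastCompensator 𝓕 (κ p) (S p) (a p) (fun k => w k p) := by
  obtain ⟨a, ham, ha⟩ := exists_measurable_isCompensator κ 𝓕 h𝓕 hSm hsub
  obtain ⟨c, hcN⟩ : ∃ c : ℕ → ℝ≥0, ∀ N : ℕ, c N = N := ⟨fun N => N, fun N => rfl⟩
  obtain ⟨ν, hν, hν0⟩ := exists_measure_nat_pos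
  have hη : ∀ p, (κ ×ₖ Kernel.const 𝔓 ν) p = (κ p).prod ν := fun p => by
    rw [Kernel.prod_apply, Kernel.const_apply]
  have hfp : ∀ n p, Measurable (fun x : Ω × ℕ => stepSum (a p) n (c x.2) x.1) := fun n p => by
    have h := (measurable_stepSum_seq ham c n).comp (measurable_prodMk_left (x := p))
    exact h
  -- Integer time becomes a second coordinate with law `ν`, so one tree serves all integer times.
  -- Uniform integrability on the product holds because the excess bound does not depend on the
  -- time; positivity of each `ν {N}` later recovers the individual times.
  obtain ⟨w, hwm, hwk, hwd⟩ := exists_measurable_midpoints (κ ×ₖ Kernel.const 𝔓 ν)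
    (f := fun n p x => stepSum (a p) n (c x.2) x.1) (measurable_stepSum_seq ham c)
    (fun n p x => stepSum_nonneg (ha p).nonneg n _ _) fun p ε hε => by
      obtain ⟨C, hC⟩ := (ha p).exists_excess_le (fun t => (hsub p).integrable t) (hD p) hε
      refine ⟨C, fun n => ?_⟩
      rw [hη, lintegral_prod_symm' _ ((hfp n p).sub_const C).ennreal_ofReal]
      calc ∫⁻ N, ∫⁻ ω, ENNReal.ofReal (stepSum (a p) n (c N) ω - C) ∂κ p ∂ν
          ≤ ∫⁻ _, ENNReal.ofReal ε ∂ν := lintegral_mono fun N => hC n _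
        _ = ENNReal.ofReal ε := by rw [lintegral_const, measure_univ, mul_one]
  refine ⟨a, w, ham, hwm, fun p => ⟨ha p, fun k => hwk k p, fun N => ?_,
    fun t => (hsub p).integrable t⟩⟩
  have hN : ∀ k, (∫⁻ ω, ‖midSum (a p) (fun k => w k p) (k + 1) (c N) ω
      - midSum (a p) (fun k => w k p) k (c N) ω‖ₑ ∂κ p) * ν {N} ≤ ENNReal.ofReal ((1 / 2) ^ k) := by
    intro k
    have h1 := hwd k p
    rw [hη] at h1
    refine le_trans (lintegral_mul_singleton_le (f := fun x : Ω × ℕ =>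
      ‖(w (k + 1) p).eval (fun n => stepSum (a p) n (c x.2) x.1)
        - (w k p).eval (fun n => stepSum (a p) n (c x.2) x.1)‖ₑ) ?_ N) h1
    exact ((MidTree.measurable_eval (fun n => hfp n p) (w (k + 1) p)).sub
      (MidTree.measurable_eval (fun n => hfp n p) (w k p))).enorm
  have hsum := ne_top_of_le_ne_top tsum_ofReal_half_pow_ne_top (ENNReal.tsum_le_tsum hN)
  rw [ENNReal.tsum_mul_right] at hsum
  rw [← hcN]
  exact fun htop => hsum (by rw [htop, ENNReal.top_mul (hν0 N)])

/-- The Doob–Meyer decomposition of a process of class D, measurably in a parameter on which the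
process and its law depend. -/
theorem exists_measurable_doobMeyer (κ : Kernel 𝔓 Ω) [IsMarkovKernel κ]
    (𝓕 : Filtration ℝ≥0 mΩ) (h𝓕 : ∀ t, @MeasurableSpace.CountablyGenerated Ω (𝓕 t))
    {S : 𝔓 → ℝ≥0 → Ω → ℝ} (hSm : Measurable (fun x : 𝔓 × Ω × ℝ≥0 => S x.1 x.2.2 x.2.1))
    (hrc : ∀ p, RightContinuousPaths (S p)) (hSa : ∀ p, StronglyAdapted 𝓕.rightCont (S p))
    (hsub : ∀ p, Submartingale (S p) (usualAugmentation 𝓕 (κ p)) (κ p))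
    (hD : ∀ p, IsClassD (S p) (usualAugmentation 𝓕 (κ p)) (κ p)) :
    ∃ A : 𝔓 → ℝ≥0 → Ω → ℝ, Measurable (fun x : 𝔓 × Ω × ℝ≥0 => A x.1 x.2.2 x.2.1) ∧
      ∀ p, Martingale (fun t ω => S p t ω - S p 0 ω - A p t ω) (usualAugmentation 𝓕 (κ p)) (κ p) ∧
        RightContinuousPaths (A p) ∧ StronglyAdapted 𝓕.rightCont (A p) ∧
        IsAugPredictable 𝓕 (κ p) (A p) ∧ ∀ᵐ ω ∂κ p, Monotone (fun t => A p t ω) := by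
  obtain ⟨a, w, ha, hw, h⟩ := exists_measurable_isFastCompensator κ 𝓕 h𝓕 hSm hsub hD
  refine ⟨fun p t ω => (regSum (a p) (fun k => w k p) t ω).toReal,
    (measurable_regSum_prod ha hw).ennreal_toReal, fun p =>
    ⟨(h p).martingale (hD p) (hrc p) (hSa p), rightContinuousPaths_regSum (h p).nonneg,
      fun t => ?_, (h p).isAugPredictable (hD p) (hrc p), (h p).ae_monotone⟩⟩
  exact (measurable_regSum (h p).nonneg (h p).measurable t).ennreal_toReal.stronglyMeasurable

end Decomposition

/-- The inclusion of the probability measures, with the Borel sigma-field of the topology of weak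
convergence, into the measures is measurable. -/
theorem measurable_coe_probabilityMeasure {Ω : Type*} [MetricSpace Ω] [mΩ : MeasurableSpace Ω]
    [BorelSpace Ω] (𝔓 : Set (ProbabilityMeasure Ω)) :
    Measurable[borel 𝔓] (fun P : 𝔓 => ((P : ProbabilityMeasure Ω) : Measure Ω)) := by
  let _ : MeasurableSpace 𝔓 := borel 𝔓
  have : BorelSpace 𝔓 := ⟨rfl⟩
  -- It suffices to evaluate measures on closed sets. The indicator of a closed set is a limit of
  -- bounded continuous functions, whose integrals are weakly continuous in the measure.
  refine Measurable.measure_of_isPiSystem_of_isProbabilityMeasure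
    (BorelSpace.measurable_eq.trans borel_eq_generateFrom_isClosed) isPiSystem_isClosed
    fun F (hF : IsClosed F) => ?_
  have hδ : ∀ n : ℕ, (0 : ℝ) < 1 / ((n : ℝ) + 1) := fun n => Nat.one_div_pos_of_nat
  refine measurable_of_tendsto_metrizable (f := fun (n : ℕ) (P : 𝔓) =>
    ∫⁻ ω, (thickenedIndicator (hδ n) F ω : ℝ≥0∞) ∂((P : ProbabilityMeasure Ω) : Measure Ω))
    (fun n => ?_) (tendsto_pi_nhds.2 fun P =>
      tendsto_lintegral_thickenedIndicator_of_isClosed _ hF hδ tendsto_one_div_add_atTop_nhds_zero_nat)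
  exact ((ProbabilityMeasure.continuous_lintegral_boundedContinuousFunction
    (thickenedIndicator (hδ n) F)).comp continuous_subtype_val).measurable

end DoobMeyer

theorem mainTheorem6 {Ω : Type*} [MetricSpace Ω] [TopologicalSpace.SeparableSpace Ω]
    [mΩ : MeasurableSpace Ω] [BorelSpace Ω]
    (𝓕 : Filtration ℝ≥0 mΩ)
    (h𝓕 : ∀ t, @MeasurableSpace.CountablyGenerated Ω (𝓕 t))
    (𝔓 : Set (ProbabilityMeasure Ω)) (h𝔓 : MeasurableSet[borel (ProbabilityMeasure Ω)] 𝔓)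
    (S : 𝔓 → ℝ≥0 → Ω → ℝ)
    (hS_meas : DoobMeyer.JointlyMeasurable S)
    (hS_rc : ∀ P : 𝔓, DoobMeyer.RightContinuousPaths (S P))
    (hS_adapted : ∀ P : 𝔓, StronglyAdapted 𝓕.rightCont (S P))
    (hS_sub : ∀ P : 𝔓, Submartingale (S P)
      (DoobMeyer.usualAugmentation 𝓕 (P : Measure Ω)) (P : Measure Ω))
    (hS_classD : ∀ P : 𝔓, DoobMeyer.IsClassD (S P)
      (DoobMeyer.usualAugmentation 𝓕 (P : Measure Ω)) (P : Measure Ω)) :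
    ∃ A : 𝔓 → ℝ≥0 → Ω → ℝ,
      DoobMeyer.JointlyMeasurable A ∧
      ∀ P : 𝔓,
        Martingale (fun t ω => S P t ω - S P 0 ω - A P t ω)
          (DoobMeyer.usualAugmentation 𝓕 (P : Measure Ω)) (P : Measure Ω) ∧
        DoobMeyer.RightContinuousPaths (A P) ∧
        StronglyAdapted 𝓕.rightCont (A P) ∧
        DoobMeyer.IsAugPredictable 𝓕 (P : Measure Ω) (A P) ∧
        ∀ᵐ ω ∂(P : Measure Ω), Monotone (fun t => A P t ω) := by
  let _ : MeasurableSpace 𝔓 := borel 𝔓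
  let κ : ProbabilityTheory.Kernel 𝔓 Ω :=
    ⟨fun P => ((P : ProbabilityMeasure Ω) : Measure Ω), DoobMeyer.measurable_coe_probabilityMeasure 𝔓⟩
  have : ProbabilityTheory.IsMarkovKernel κ :=
    ⟨fun P => (inferInstance : IsProbabilityMeasure ((P : ProbabilityMeasure Ω) : Measure Ω))⟩
  exact DoobMeyer.exists_measurable_doobMeyer κ 𝓕 h𝓕 hS_meas hS_rc hS_adapted hS_sub hS_classD
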